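/- For an integer $N\ge 2$ and $p\in[0,1]$ let $A$ be the adjacency matrix of the Erdős–Rényi random graph $G(N,p)$ on $N$ vertices (each of the $\binom N2$ edges is present independently with probability $p$), and label its eigenvalues, counted with multiplicity, in non-increasing order of modulus: $|\lambda_1(A)|\ge|\lambda_2(A)|\ge\cdots\ge|\lambda_N(A)|$. There exist absolute constants $c>0$ and $C,C_1<\infty$ such that for every integer $N\ge 2$, every $p\in[0,1]$ with $Np\ge\log N$, and every $K\ge C$, the following holds outside an event of probability at most $4N\exp(-cK^2N^2p^2)$: for all integers $1\le R\le N$ and all real $\alpha>2$ simultaneously, $$|\lambda_R(A)|\le C_1\Big(\sqrt{Np}+\frac{KNp}{\sqrt R}\Big)$$ and $$\sum_{j=R+1}^{N}|\lambda_j(A)|^\alpha\le C_1^{\alpha}\Big(N^{1+\alpha/2}p^{\alpha/2}+\frac{(KNp)^\alpha}{R^{\alpha/2-1}}\Big).$$ -/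

import Mathlib

/-- The `j`-th eigenvalue `λ_j` (`1 ≤ j ≤ N`, counted with multiplicity) of a real symmetric
`N × N` matrix, the eigenvalues being labelled in non-increasing order of modulus,
`|λ_1| ≥ |λ_2| ≥ ⋯ ≥ |λ_N|`. For `j` outside `{1, …, N}` the value is `0`. -/
noncomputable def eigenvalueByModulus {N : ℕ} {A : Matrix (Fin N) (Fin N) ℝ}
    (hA : A.IsHermitian) (j : ℕ) : ℝ :=
  if h : 1 ≤ j ∧ j ≤ N then
    hA.eigenvalues (Tuple.sort (fun i => -|hA.eigenvalues i|) ⟨j - 1, by omega⟩)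
  else 0

open Classical in
/-- `λ_j(A_G)`, where `A_G` is the adjacency matrix of the graph `G` on `N` vertices. -/
noncomputable def adjEigenvalue {N : ℕ} (G : SimpleGraph (Fin N)) (j : ℕ) : ℝ :=
  eigenvalueByModulus (G.isHermitian_adjMatrix ℝ) j

/-! For each `R`, the quantity to control is the ℓ² norm of the `R` eigenvalues of largest modulus.
It is at most a support function `kyFan R`: a supremum of linear functionals over matrices of
Frobenius norm at most `1` and nuclear norm at most `√R` (`exists_testMatrix_eigenvalues`). Take
this function at the centred matrix, with loops kept so that the entries indexed by `Sym2` are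
independent. The Frobenius bound makes it a convex `√2`-Lipschitz function of the entries, and the
nuclear bound makes its mean at most `√R` times the mean operator norm. Concentration of convex
Lipschitz functions, derived from Maurey's infimum-convolution inequality `maurey_cube`, bounds the
probability of exceeding the mean bound by `KNp` by `exp(-(KNp)²/16)`; a union bound over `R` costs
a factor `N`. Undoing the centring costs `pN`, the Frobenius norm of its mean, and removing the
loops costs `√R` (`sqrt_sum_adjEigenvalue_sq_le`). On the resulting event both estimates, for every
`α` at once, are deterministic (`bounds_of_l2_initial_segments`).

The mean operator norm is `O(√(Np))` (`expected_centered_norm_le`). After symmetrisation, the trace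
of the `2k`-th power with `k = ⌈Np⌉` sees only closed walks using every edge an even number of
times. `sum_even_walks_le` compares them with even walks on `4k` vertices by matching walks with the
same pattern of coincidences. The latter are counted by a trace moment of a `4k × 4k` random sign
matrix, for which a net argument loses only a factor `C^k`. Since `Np ≥ log N`, the remaining factor
`N` is also at most `C^k`. -/

open MeasureTheory
open scoped Matrix.Norms.L2Operator RealInnerProductSpace

/-! ### Finite product weights -/

/-- The product weight on functions `ω : E → Ω` built from a weight `μ` on `Ω`. -/
noncomputable def prodWeight {E Ω : Type*} [Fintype E] (μ : Ω → ℝ) (ω : E → Ω) : ℝ :=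
  ∏ e, μ (ω e)

/-- The Bernoulli weight with parameter `p`. -/
noncomputable def bernoulliWeight (p : ℝ) (b : Bool) : ℝ := if b then p else 1 - p

/-- The number `0` or `1` given by a Boolean. -/
noncomputable def boolReal (b : Bool) : ℝ := if b then 1 else 0

lemma boolReal_mem (b : Bool) : boolReal b ∈ Set.Icc (0 : ℝ) 1 := by
  cases b <;> simp [boolReal]

lemma sum_prodWeight_mul_prod {E Ω : Type*} [Fintype E] [DecidableEq E] [Fintype Ω]
    (μ : Ω → ℝ) (F : E → Ω → ℝ) :
    ∑ ω : E → Ω, prodWeight μ ω * ∏ e, F e (ω e) = ∏ e, ∑ x, μ x * F e x := by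
  rw [Finset.prod_univ_sum, Fintype.piFinset_univ]
  simp only [prodWeight, Finset.prod_mul_distrib]

lemma sum_prodWeight {E Ω : Type*} [Fintype E] [DecidableEq E] [Fintype Ω]
    {μ : Ω → ℝ} (hμ : ∑ x, μ x = 1) : ∑ ω : E → Ω, prodWeight μ ω = 1 := by
  simpa [hμ] using sum_prodWeight_mul_prod (E := E) μ (fun _ _ => 1)

lemma prodWeight_nonneg {E Ω : Type*} [Fintype E] {μ : Ω → ℝ} (hμ : ∀ x, 0 ≤ μ x)
    (ω : E → Ω) : 0 ≤ prodWeight μ ω :=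
  Finset.prod_nonneg fun _ _ => hμ _

lemma bernoulliWeight_nonneg {p : ℝ} (hp : p ∈ Set.Icc (0 : ℝ) 1) (b : Bool) :
    0 ≤ bernoulliWeight p b := by
  cases b <;> simp [bernoulliWeight, hp.1, hp.2]

lemma sum_bernoulliWeight (p : ℝ) : ∑ b, bernoulliWeight p b = 1 := by
  simp [bernoulliWeight]

/-! ### Maurey's inequality on the cube -/

/-- The first-order terms cancel, and the correction `-2δ²` outweighs the second-order terms of both
exponentials. -/
lemma exp_add_exp_neg_le_two {δ : ℝ} (h0 : 0 ≤ δ) (h1 : δ ≤ 1 / 4) :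
    Real.exp (δ - 2 * δ ^ 2) + Real.exp (-δ) ≤ 2 := by
  have e1 : Real.exp (δ - 2 * δ ^ 2) ≤ 1 + (δ - 2 * δ ^ 2) + (δ - 2 * δ ^ 2) ^ 2 := by
    have := Real.abs_exp_sub_one_sub_id_le (x := δ - 2 * δ ^ 2)
      (by rw [abs_le]; constructor <;> nlinarith)
    have := (abs_le.1 this).2
    linarith
  have e2 : Real.exp (-δ) ≤ 1 - δ + δ ^ 2 / 2 := by
    have hq := Real.quadratic_le_exp_of_nonneg h0
    rw [Real.exp_neg, inv_le_iff_one_le_mul₀ (Real.exp_pos _)]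
    nlinarith [mul_nonneg (mul_nonneg h0 h0) (mul_nonneg h0 h0)]
  nlinarith [mul_nonneg h0 h0, mul_nonneg (mul_nonneg h0 h0) h0, mul_nonneg (mul_nonneg h0 h0) (sub_nonneg.2 h1)]

/-- This is the one-coordinate case of Maurey's inequality. With `δ = ψ₁ - ψ₀`, optimising `θ²/8 -
θδ` over `θ` gives `A₁ ≤ exp (ψ₀ + h)` with `h ≤ δ` and `exp h + exp (-δ) ≤ 2`; the product is then
at most `((1 - p) + p)²`. -/
lemma two_point_aux {p ψ₀ ψ₁ A₀ A₁ B₀ B₁ : ℝ} (hp : p ∈ Set.Icc (0 : ℝ) 1)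
    (hA₀ : 0 ≤ A₀) (hA₁ : 0 ≤ A₁) (hψ : ψ₀ ≤ ψ₁)
    (h₀ : A₀ ≤ Real.exp ψ₀)
    (h₁ : ∀ θ ∈ Set.Icc (0 : ℝ) 1, A₁ ≤ Real.exp (θ ^ 2 / 8 + ((1 - θ) * ψ₁ + θ * ψ₀)))
    (hB₀ : B₀ ≤ Real.exp (-ψ₀)) (hB₁ : B₁ ≤ Real.exp (-ψ₁)) :
    ((1 - p) * A₀ + p * A₁) * ((1 - p) * B₀ + p * B₁) ≤ 1 := by
  obtain ⟨hp0, hp1⟩ := hp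
  obtain ⟨δ, hδ⟩ : ∃ δ, δ = ψ₁ - ψ₀ := ⟨_, rfl⟩
  have hδ0 : 0 ≤ δ := by linarith
  obtain ⟨h, hA, hle, hsum⟩ : ∃ h, A₁ ≤ Real.exp ψ₀ * Real.exp h ∧ h ≤ δ ∧
      Real.exp h + Real.exp (-δ) ≤ 2 := by
    by_cases hd : δ ≤ 1 / 4
    -- The unconstrained minimiser is `θ = 4δ`, admissible exactly while `δ ≤ 1/4`; beyond that `θ =
    -- 1` is used.
    · refine ⟨δ - 2 * δ ^ 2, ?_, by nlinarith, exp_add_exp_neg_le_two hδ0 hd⟩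
      rw [← Real.exp_add]
      convert h₁ (4 * δ) ⟨by linarith, by linarith⟩ using 2
      rw [hδ]; ring
    · push Not at hd
      refine ⟨1 / 8, ?_, by linarith, ?_⟩
      · rw [← Real.exp_add]
        convert h₁ 1 ⟨by norm_num, le_rfl⟩ using 2
        ring
      · have a1 : Real.exp (1 / 8) ≤ 8 / 7 := by
          have := Real.add_one_le_exp (-(1 / 8 : ℝ))
          rw [Real.exp_neg] at this
          have h8 := Real.exp_pos (1 / 8)
          rw [le_inv_comm₀ (by norm_num) h8] at this
          norm_num at this ⊢
          linarith
        have a2 : Real.exp (-δ) ≤ 4 / 5 := by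
          have h8 : 5 / 4 ≤ Real.exp δ := by linarith [Real.add_one_le_exp δ]
          rw [Real.exp_neg, inv_le_comm₀ (Real.exp_pos _) (by norm_num)]
          linarith
        linarith
  have hprod : Real.exp h * Real.exp (-δ) ≤ 1 := by
    rw [← Real.exp_add]; exact Real.exp_le_one_iff.2 (by linarith)
  have hB₁' : B₁ ≤ Real.exp (-ψ₀) * Real.exp (-δ) := by
    rw [← Real.exp_add]; convert hB₁ using 2; rw [hδ]; ring
  have hone : Real.exp ψ₀ * Real.exp (-ψ₀) = 1 := by rw [← Real.exp_add]; simp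
  have hq : 0 ≤ 1 - p := by linarith
  calc ((1 - p) * A₀ + p * A₁) * ((1 - p) * B₀ + p * B₁)
      ≤ ((1 - p) * A₀ + p * A₁) *
        ((1 - p) * Real.exp (-ψ₀) + p * (Real.exp (-ψ₀) * Real.exp (-δ))) := by gcongr
    _ ≤ ((1 - p) * Real.exp ψ₀ + p * (Real.exp ψ₀ * Real.exp h)) *
        ((1 - p) * Real.exp (-ψ₀) + p * (Real.exp (-ψ₀) * Real.exp (-δ))) := by gcongr
    _ = (Real.exp ψ₀ * Real.exp (-ψ₀)) *
        ((1 - p) ^ 2 + p * (1 - p) * (Real.exp h + Real.exp (-δ)) +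
          p ^ 2 * (Real.exp h * Real.exp (-δ))) := by ring
    _ ≤ 1 * ((1 - p) ^ 2 + p * (1 - p) * 2 + p ^ 2 * 1) := by
        rw [hone]; gcongr
    _ = 1 := by ring

lemma two_point {p ψ₀ ψ₁ A₀ A₁ B₀ B₁ : ℝ} (hp : p ∈ Set.Icc (0 : ℝ) 1)
    (hA₀ : 0 ≤ A₀) (hA₁ : 0 ≤ A₁)
    (h₀ : ∀ θ ∈ Set.Icc (0 : ℝ) 1, A₀ ≤ Real.exp (θ ^ 2 / 8 + ((1 - θ) * ψ₀ + θ * ψ₁)))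
    (h₁ : ∀ θ ∈ Set.Icc (0 : ℝ) 1, A₁ ≤ Real.exp (θ ^ 2 / 8 + ((1 - θ) * ψ₁ + θ * ψ₀)))
    (hB₀ : B₀ ≤ Real.exp (-ψ₀)) (hB₁ : B₁ ≤ Real.exp (-ψ₁)) :
    ((1 - p) * A₀ + p * A₁) * ((1 - p) * B₀ + p * B₁) ≤ 1 := by
  rcases le_total ψ₀ ψ₁ with h | h
  · exact two_point_aux hp hA₀ hA₁ h (by simpa using h₀ 0 (by simp)) h₁ hB₀ hB₁
  · have := two_point_aux (p := 1 - p) ⟨by linarith [hp.2], by linarith [hp.1]⟩ hA₁ hA₀ h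
      (by simpa using h₁ 0 (by simp)) h₀ hB₁ hB₀
    convert this using 1
    ring

/-- A weighted form of Hölder's inequality for exponentials. -/
lemma sum_weight_exp_le {ι : Type*} [Fintype ι] {w : ι → ℝ} (hw : ∀ i, 0 ≤ w i)
    {G₀ G₁ : ι → ℝ} {ψ₀ ψ₁ θ : ℝ} (hθ : θ ∈ Set.Icc (0 : ℝ) 1)
    (h₀ : ∑ i, w i * Real.exp (G₀ i) = Real.exp ψ₀)
    (h₁ : ∑ i, w i * Real.exp (G₁ i) = Real.exp ψ₁) :
    ∑ i, w i * Real.exp ((1 - θ) * G₀ i + θ * G₁ i) ≤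
      Real.exp ((1 - θ) * ψ₀ + θ * ψ₁) := by
  have key : ∀ i, w i * Real.exp ((1 - θ) * G₀ i + θ * G₁ i) ≤
      Real.exp ((1 - θ) * ψ₀ + θ * ψ₁) *
        ((1 - θ) * (w i * Real.exp (G₀ i)) * Real.exp (-ψ₀) +
          θ * (w i * Real.exp (G₁ i)) * Real.exp (-ψ₁)) := fun i => by
    have := convexOn_exp.2 (Set.mem_univ (G₀ i - ψ₀)) (Set.mem_univ (G₁ i - ψ₁))
      (sub_nonneg.2 hθ.2) hθ.1 (by ring)
    simp only [smul_eq_mul] at this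
    calc w i * Real.exp ((1 - θ) * G₀ i + θ * G₁ i)
        = Real.exp ((1 - θ) * ψ₀ + θ * ψ₁) * (w i *
          Real.exp ((1 - θ) * (G₀ i - ψ₀) + θ * (G₁ i - ψ₁))) := by
          rw [mul_left_comm, ← Real.exp_add]; congr 2; ring
      _ ≤ Real.exp ((1 - θ) * ψ₀ + θ * ψ₁) * (w i *
          ((1 - θ) * Real.exp (G₀ i - ψ₀) + θ * Real.exp (G₁ i - ψ₁))) := by
          gcongr; exact hw i
      _ = _ := by
          rw [sub_eq_add_neg (G₀ i), sub_eq_add_neg (G₁ i), Real.exp_add (G₀ i),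
            Real.exp_add (G₁ i)]; ring
  refine (Finset.sum_le_sum fun i _ => key i).trans (le_of_eq ?_)
  rw [← Finset.mul_sum, Finset.sum_add_distrib, ← Finset.sum_mul, ← Finset.sum_mul,
    ← Finset.mul_sum, ← Finset.mul_sum, h₀, h₁, mul_assoc, mul_assoc, ← Real.exp_add,
    ← Real.exp_add]
  simp

lemma sum_fin_succ_bool {n : ℕ} (p : ℝ) (F : (Fin (n + 1) → Bool) → ℝ) :
    ∑ x, prodWeight (bernoulliWeight p) x * F x =
      (1 - p) * ∑ x, prodWeight (bernoulliWeight p) x * F (Fin.cons false x) +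
        p * ∑ x, prodWeight (bernoulliWeight p) x * F (Fin.cons true x) := by
  rw [← (Fin.consEquiv fun _ : Fin (n + 1) => Bool).sum_comp, Fintype.sum_prod_type,
    Fintype.sum_bool, add_comm, Finset.mul_sum, Finset.mul_sum]
  congr 1 <;> refine Finset.sum_congr rfl fun x _ => ?_ <;>
    simp [prodWeight, Fin.prod_univ_succ, bernoulliWeight, Fin.consEquiv] <;> ring

/-- Maurey's property for products of Bernoulli measures: transport-type inequality for
convex functions on the cube. -/
theorem maurey_cube {p : ℝ} (hp : p ∈ Set.Icc (0 : ℝ) 1) (n : ℕ) :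
    ∀ (φ : (Fin n → ℝ) → ℝ), ConvexOn ℝ Set.univ φ → Continuous φ →
    ∀ g : (Fin n → Bool) → ℝ,
      (∀ x y, (∀ i, y i ∈ Set.Icc (0 : ℝ) 1) →
        g x ≤ φ y + (∑ i, (boolReal (x i) - y i) ^ 2) / 8) →
      (∑ x, prodWeight (bernoulliWeight p) x * Real.exp (g x)) *
        (∑ x, prodWeight (bernoulliWeight p) x * Real.exp (-φ fun i => boolReal (x i))) ≤ 1 := by
  induction n with
  | zero =>
    intro φ _ _ g hg
    rw [Fintype.sum_unique, Fintype.sum_unique]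
    have h := fun x : Fin 0 → Bool => hg x (fun i => boolReal (x i)) (fun i => i.elim0)
    simp only [prodWeight, Finset.univ_eq_empty, Finset.prod_empty, one_mul, Finset.sum_empty,
      zero_div, add_zero] at h ⊢
    rw [← Real.exp_add, Real.exp_le_one_iff, ← sub_eq_add_neg]
    exact sub_nonpos.2 (h _)
  | succ n ih =>
    intro φ hφ hc g hg
    have hw := prodWeight_nonneg (E := Fin n) (bernoulliWeight_nonneg hp)
    have hw1 := sum_prodWeight (E := Fin n) (sum_bernoulliWeight p)
    have hslice : ∀ s : ℝ, Continuous fun y : Fin n → ℝ => φ (Fin.cons s y) := fun s =>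
      hc.comp (by fun_prop)
    have hmin : ∀ (s : ℝ) (x : Fin n → Bool), ∃ y ∈ Set.univ.pi fun _ : Fin n => Set.Icc (0 : ℝ) 1,
        IsMinOn (fun y : Fin n → ℝ => φ (Fin.cons s y) + (∑ i, (boolReal (x i) - y i) ^ 2) / 8)
          (Set.univ.pi fun _ : Fin n => Set.Icc (0 : ℝ) 1) y := fun s x => by
      refine (isCompact_univ_pi fun _ => isCompact_Icc).exists_isMinOn
        ⟨fun _ => 0, fun i _ => by simp⟩ ?_
      exact ((hslice s).add (by fun_prop)).continuousOn
    choose Y hYmem hYmin using hmin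
    -- `G s` is the infimum convolution of the slice of `φ` at first coordinate `s` with the
    -- quadratic cost, and `ψ s` is the logarithm of its exponential moment. The induction
    -- hypothesis applies to each slice.
    set G : ℝ → (Fin n → Bool) → ℝ := fun s x =>
      φ (Fin.cons s (Y s x)) + (∑ i, (boolReal (x i) - Y s x i) ^ 2) / 8 with hG
    have hpos : ∀ s, 0 < ∑ x, prodWeight (bernoulliWeight p) x * Real.exp (G s x) := fun s => by
      refine lt_of_le_of_ne (Finset.sum_nonneg fun x _ => mul_nonneg (hw x) (Real.exp_pos _).le)
        fun h => ?_
      rw [eq_comm, Finset.sum_eq_zero_iff_of_nonneg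
        fun x _ => mul_nonneg (hw x) (Real.exp_pos _).le] at h
      rw [Finset.sum_eq_zero fun x hx => by
        simpa [(Real.exp_pos (G s x)).ne'] using h x hx] at hw1
      exact zero_ne_one hw1
    set ψ : ℝ → ℝ := fun s => Real.log (∑ x, prodWeight (bernoulliWeight p) x * Real.exp (G s x))
      with hψ
    have hexp : ∀ s, ∑ x, prodWeight (bernoulliWeight p) x * Real.exp (G s x) =
        Real.exp (ψ s) := fun s => (Real.exp_log (hpos s)).symm
    have hB : ∀ s, ∑ x, prodWeight (bernoulliWeight p) x *
        Real.exp (-φ (Fin.cons s fun i => boolReal (x i))) ≤ Real.exp (-ψ s) := fun s => by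
      have hcv : ConvexOn ℝ Set.univ fun y : Fin n → ℝ => φ (Fin.cons s y) := by
        refine ⟨convex_univ, fun y _ z _ a b ha hb hab => ?_⟩
        have := hφ.2 (Set.mem_univ (Fin.cons s y)) (Set.mem_univ (Fin.cons s z)) ha hb hab
        convert this using 2
        ext i
        refine Fin.cases ?_ (fun i => ?_) i
        · simp [← add_mul, hab]
        · simp
      have := ih _ hcv (hslice s) (G s) fun x y hy => hYmin s x (fun i _ => hy i)
      rw [hexp] at this
      rw [Real.exp_neg]
      exact (le_inv_mul_iff₀ (Real.exp_pos _)).2 this |>.trans (by simp)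
    -- Testing `hg` at a mixture of the minimisers for `s` and `t` costs `θ²/8` in the first
    -- coordinate. Convexity of `φ` and of the square handles the rest, and Hölder turns the mixture
    -- of `G` into a mixture of `ψ`.
    have hint : ∀ (b : Bool) (s t : ℝ), s ∈ Set.Icc (0 : ℝ) 1 → t ∈ Set.Icc (0 : ℝ) 1 →
        ∀ θ ∈ Set.Icc (0 : ℝ) 1, (boolReal b - ((1 - θ) * s + θ * t)) ^ 2 = θ ^ 2 →
        ∑ x, prodWeight (bernoulliWeight p) x * Real.exp (g (Fin.cons b x)) ≤
          Real.exp (θ ^ 2 / 8 + ((1 - θ) * ψ s + θ * ψ t)) := fun b s t hs ht θ hθ hb => by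
      have hg' : ∀ x, g (Fin.cons b x) ≤ θ ^ 2 / 8 + ((1 - θ) * G s x + θ * G t x) := fun x => by
        have hθ' : 0 ≤ 1 - θ := sub_nonneg.2 hθ.2
        have h1 := hg (Fin.cons b x)
          ((1 - θ) • Fin.cons s (Y s x) + θ • Fin.cons t (Y t x)) (fun i => by
            refine (convex_Icc (0 : ℝ) 1) ?_ ?_ hθ' hθ.1 (by ring)
            · refine Fin.cases ?_ (fun i => ?_) i
              · simpa using hs
              · simpa using hYmem s x i trivial
            · refine Fin.cases ?_ (fun i => ?_) i
              · simpa using ht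
              · simpa using hYmem t x i trivial)
        have h2 := hφ.2 (Set.mem_univ (Fin.cons s (Y s x))) (Set.mem_univ (Fin.cons t (Y t x)))
          hθ' hθ.1 (by ring)
        have h3 : ∑ i, (boolReal (x i) - ((1 - θ) * Y s x i + θ * Y t x i)) ^ 2 ≤
            (1 - θ) * ∑ i, (boolReal (x i) - Y s x i) ^ 2 +
              θ * ∑ i, (boolReal (x i) - Y t x i) ^ 2 := by
          rw [Finset.mul_sum, Finset.mul_sum, ← Finset.sum_add_distrib]
          refine Finset.sum_le_sum fun i _ => ?_
          nlinarith [mul_nonneg (mul_nonneg hθ' hθ.1) (sq_nonneg (Y s x i - Y t x i))]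
        rw [Fin.sum_univ_succ] at h1
        simp only [Fin.cons_zero, Fin.cons_succ, Pi.add_apply, Pi.smul_apply, smul_eq_mul,
          hb] at h1 h2
        simp only [hG]
        linarith
      calc _ ≤ ∑ x, prodWeight (bernoulliWeight p) x *
            Real.exp (θ ^ 2 / 8 + ((1 - θ) * G s x + θ * G t x)) :=
            Finset.sum_le_sum fun x _ =>
              mul_le_mul_of_nonneg_left (Real.exp_le_exp.2 (hg' x)) (hw x)
        _ = Real.exp (θ ^ 2 / 8) * ∑ x, prodWeight (bernoulliWeight p) x *
            Real.exp ((1 - θ) * G s x + θ * G t x) := by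
            rw [Finset.mul_sum]
            refine Finset.sum_congr rfl fun x _ => ?_
            rw [Real.exp_add]; ring
        _ ≤ Real.exp (θ ^ 2 / 8) * Real.exp ((1 - θ) * ψ s + θ * ψ t) := by
            gcongr; exact sum_weight_exp_le hw hθ (hexp s) (hexp t)
        _ = _ := by rw [← Real.exp_add]
    rw [sum_fin_succ_bool, sum_fin_succ_bool p fun x => Real.exp (-φ fun i => boolReal (x i))]
    refine two_point (ψ₀ := ψ 0) (ψ₁ := ψ 1) hp ?_ ?_ ?_ ?_ ?_ ?_
    · exact Finset.sum_nonneg fun x _ => mul_nonneg (hw x) (Real.exp_pos _).le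
    · exact Finset.sum_nonneg fun x _ => mul_nonneg (hw x) (Real.exp_pos _).le
    · exact fun θ hθ => hint false 0 1 (by simp) (by simp) θ hθ (by simp [boolReal])
    · exact fun θ hθ => hint true 1 0 (by simp) (by simp) θ hθ (by simp [boolReal])
    · refine (le_of_eq ?_).trans (hB 0)
      refine Finset.sum_congr rfl fun x _ => ?_
      congr 4; ext i; refine Fin.cases ?_ (fun i => ?_) i <;> simp [boolReal]
    · refine (le_of_eq ?_).trans (hB 1)
      refine Finset.sum_congr rfl fun x _ => ?_
      congr 4; ext i; refine Fin.cases ?_ (fun i => ?_) i <;> simp [boolReal]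

/-! ### Concentration of convex Lipschitz functions -/

lemma sum_prodWeight_comp_equiv {E E' Ω : Type*} [Fintype E] [DecidableEq E] [Fintype E']
    [DecidableEq E'] [Fintype Ω] (σ : E ≃ E') (μ : Ω → ℝ) (F : (E → Ω) → ℝ) :
    ∑ ω : E' → Ω, prodWeight μ ω * F (ω ∘ σ) = ∑ ω : E → Ω, prodWeight μ ω * F ω := by
  refine Fintype.sum_equiv (σ.symm.arrowCongr (Equiv.refl Ω)) _ _ fun ω => ?_
  have : prodWeight μ (σ.symm.arrowCongr (Equiv.refl Ω) ω) = prodWeight μ ω := by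
    simp only [prodWeight]
    exact σ.prod_comp fun e => μ (ω e)
  rw [this]
  rfl

/-- Exponential moments of a convex Lipschitz function on a product of Bernoulli spaces. -/
theorem convex_exp_moment {E : Type*} [Fintype E] [DecidableEq E] {p : ℝ}
    (hp : p ∈ Set.Icc (0 : ℝ) 1) {f : (E → ℝ) → ℝ} (hf : ConvexOn ℝ Set.univ f) {L l : ℝ}
    (hl : 0 ≤ l) (hL : ∀ x y, f x - f y ≤ L * √(∑ e, (x e - y e) ^ 2)) :
    (∑ ω : E → Bool, prodWeight (bernoulliWeight p) ω * Real.exp (l * f fun e => boolReal (ω e))) *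
      (∑ ω : E → Bool, prodWeight (bernoulliWeight p) ω *
        Real.exp (-(l * f fun e => boolReal (ω e)))) ≤ Real.exp (2 * (l * L) ^ 2) := by
  set σ := Fintype.equivFin E
  set φ : (Fin (Fintype.card E) → ℝ) → ℝ := fun y => l * f (y ∘ σ)
  have hφ : ConvexOn ℝ Set.univ φ := by
    refine ⟨convex_univ, fun y _ z _ a b ha hb hab => ?_⟩
    have := mul_le_mul_of_nonneg_left
      (hf.2 (Set.mem_univ (y ∘ σ)) (Set.mem_univ (z ∘ σ)) ha hb hab) hl
    refine this.trans (le_of_eq ?_)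
    simp only [smul_eq_mul, φ]; ring
  have hc : Continuous φ := continuousOn_univ.1 (hφ.continuousOn isOpen_univ)
  -- The shift comes from `l * L * d ≤ 2 * (l * L) ^ 2 + d ^ 2 / 8`, where `d` is the Euclidean
  -- distance.
  have hm := maurey_cube hp _ φ hφ hc
    (fun x => l * f (fun e => boolReal (x (σ e))) - 2 * (l * L) ^ 2) (fun x y _ => by
      have h1 := mul_le_mul_of_nonneg_left (hL (fun e => boolReal (x (σ e))) (y ∘ σ)) hl
      have h2 : ∑ e, (boolReal (x (σ e)) - (y ∘ σ) e) ^ 2 = ∑ i, (boolReal (x i) - y i) ^ 2 :=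
        σ.sum_comp fun i => (boolReal (x i) - y i) ^ 2
      rw [h2] at h1
      have h3 := Real.sq_sqrt (Finset.sum_nonneg fun i (_ : i ∈ Finset.univ) =>
        sq_nonneg (boolReal (x i) - y i))
      simp only [φ]
      nlinarith [sq_nonneg (4 * (l * L) - √(∑ i, (boolReal (x i) - y i) ^ 2))])
  have e1 := sum_prodWeight_comp_equiv σ (bernoulliWeight p)
    fun ω => Real.exp (l * f fun e => boolReal (ω e))
  have e2 := sum_prodWeight_comp_equiv σ (bernoulliWeight p)
    fun ω => Real.exp (-(l * f fun e => boolReal (ω e)))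
  have e3 : ∑ x, prodWeight (bernoulliWeight p) x *
      Real.exp (l * f (fun e => boolReal (x (σ e))) - 2 * (l * L) ^ 2) =
      (∑ x, prodWeight (bernoulliWeight p) x * Real.exp (l * f (fun e => boolReal (x (σ e))))) *
        (Real.exp (2 * (l * L) ^ 2))⁻¹ := by
    rw [Finset.sum_mul]
    refine Finset.sum_congr rfl fun x _ => ?_
    rw [Real.exp_sub]; ring
  rw [e3] at hm
  rw [← e1, ← e2]
  have hpos := Real.exp_pos (2 * (l * L) ^ 2)
  rw [mul_right_comm, ← div_eq_mul_inv, div_le_one hpos] at hm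
  exact hm

/-- Upper tail of a convex Lipschitz function on a product of Bernoulli spaces. -/
theorem convex_upper_tail {E : Type*} [Fintype E] [DecidableEq E] {p : ℝ}
    (hp : p ∈ Set.Icc (0 : ℝ) 1) {f : (E → ℝ) → ℝ} (hf : ConvexOn ℝ Set.univ f) {L m t : ℝ}
    (hLpos : 0 < L) (ht : 0 ≤ t) (hL : ∀ x y, f x - f y ≤ L * √(∑ e, (x e - y e) ^ 2))
    (hm : ∑ ω : E → Bool, prodWeight (bernoulliWeight p) ω * f (fun e => boolReal (ω e)) ≤ m)
    (S : Finset (E → Bool)) (hS : ∀ ω ∈ S, m + t ≤ f fun e => boolReal (ω e)) :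
    ∑ ω ∈ S, prodWeight (bernoulliWeight p) ω ≤ Real.exp (-t ^ 2 / (8 * L ^ 2)) := by
  have hw := prodWeight_nonneg (E := E) (bernoulliWeight_nonneg hp)
  have hw1 := sum_prodWeight (E := E) (sum_bernoulliWeight p)
  set W : (E → Bool) → ℝ := prodWeight (bernoulliWeight p)
  set F : (E → Bool) → ℝ := fun ω => f fun e => boolReal (ω e)
  -- This `l` minimises the final exponent `2 * (l * L) ^ 2 - l * t`. Jensen bounds the negative
  -- exponential moment below, so only the mean enters.
  set l := t / (4 * L ^ 2) with hl
  have hl0 : 0 ≤ l := by positivity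
  have h1 := convex_exp_moment hp hf hl0 hL
  have hjensen : Real.exp (-(l * m)) ≤ ∑ ω, W ω * Real.exp (-(l * F ω)) := by
    have := convexOn_exp.map_sum_le (t := Finset.univ) (w := W) (p := fun ω => -(l * F ω))
      (fun ω _ => hw ω) hw1 (fun _ _ => Set.mem_univ _)
    simp only [smul_eq_mul] at this
    refine le_trans (Real.exp_le_exp.2 ?_) this
    have : ∑ ω, W ω * -(l * F ω) = -(l * ∑ ω, W ω * F ω) := by
      rw [Finset.mul_sum, ← Finset.sum_neg_distrib]
      exact Finset.sum_congr rfl fun _ _ => by ring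
    rw [this]
    exact neg_le_neg (mul_le_mul_of_nonneg_left hm hl0)
  have hmarkov : (∑ ω ∈ S, W ω) * Real.exp (l * (m + t)) ≤ ∑ ω, W ω * Real.exp (l * F ω) := by
    rw [Finset.sum_mul]
    refine (Finset.sum_le_sum fun ω hω => ?_).trans (Finset.sum_le_univ_sum_of_nonneg
      fun ω => mul_nonneg (hw ω) (Real.exp_pos _).le)
    exact mul_le_mul_of_nonneg_left (Real.exp_le_exp.2
      (mul_le_mul_of_nonneg_left (hS ω hω) hl0)) (hw ω)
  have hpos : 0 ≤ ∑ ω ∈ S, W ω := Finset.sum_nonneg fun ω _ => hw ω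
  have h2 : ((∑ ω ∈ S, W ω) * Real.exp (l * (m + t))) * Real.exp (-(l * m)) ≤
      Real.exp (2 * (l * L) ^ 2) :=
    (mul_le_mul hmarkov hjensen (Real.exp_pos _).le 
      (Finset.sum_nonneg fun ω _ => mul_nonneg (hw ω) (Real.exp_pos _).le)).trans h1
  rw [mul_assoc, ← Real.exp_add, ← le_div_iff₀ (Real.exp_pos _), ← Real.exp_sub] at h2
  refine h2.trans (le_of_eq ?_)
  congr 1
  rw [hl]
  field_simp
  ring

/-! ### Closed walks and trace moments -/

/-- The symmetric matrix with entries given by a function on unordered pairs. -/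
def symMatrix {V : Type*} (x : Sym2 V → ℝ) : Matrix V V ℝ := Matrix.of fun i j => x s(i, j)

/-- The `i`-th edge of a walk. -/
def walkEdge {V : Type*} {n : ℕ} (u : Fin (n + 1) → V) (i : Fin n) : Sym2 V :=
  s(u i.castSucc, u i.succ)

/-- The number of times a walk uses an edge. -/
def edgeCount {V : Type*} [DecidableEq V] {n : ℕ} (u : Fin (n + 1) → V) (e : Sym2 V) : ℕ :=
  (Finset.univ.filter fun i => walkEdge u i = e).card

/-- Closed walks using every edge an even number of times. -/
def IsEvenWalk {V : Type*} [DecidableEq V] {n : ℕ} (u : Fin (n + 1) → V) : Prop :=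
  u 0 = u (Fin.last n) ∧ ∀ e, Even (edgeCount u e)

/-- Along the walk, each newly visited vertex is entered through an edge not used before. -/
lemma card_image_le_card_edges {V : Type*} [DecidableEq V] {n : ℕ} (u : Fin (n + 1) → V) :
    (Finset.univ.image u).card ≤ (Finset.univ.image (walkEdge u)).card + 1 := by
  induction n with
  | zero =>
    simp
  | succ n ih =>
    set u' : Fin (n + 1) → V := fun i => u i.castSucc
    have hV : Finset.univ.image u = insert (u (Fin.last _)) (Finset.univ.image u') := by
      ext v
      simp only [Finset.mem_image, Finset.mem_univ, true_and, Finset.mem_insert, u']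
      rw [Fin.exists_fin_succ', or_comm, eq_comm (a := v)]
    have hE : Finset.univ.image (walkEdge u) =
        insert s(u' (Fin.last n), u (Fin.last _)) (Finset.univ.image (walkEdge u')) := by
      ext e
      simp only [Finset.mem_image, Finset.mem_univ, true_and, Finset.mem_insert]
      rw [Fin.exists_fin_succ', or_comm, eq_comm (a := e)]
      rfl
    have := ih u'
    by_cases hu : u (Fin.last _) ∈ Finset.univ.image u'
    · rw [hV, hE, Finset.insert_eq_of_mem hu]
      exact this.trans (by gcongr; exact Finset.subset_insert _ _)
    · have hnot : s(u' (Fin.last n), u (Fin.last _)) ∉ Finset.univ.image (walkEdge u') := by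
        intro hmem
        obtain ⟨i, -, hi⟩ := Finset.mem_image.1 hmem
        have : u (Fin.last _) ∈ walkEdge u' i := hi ▸ Sym2.mem_mk_right _ _
        rcases Sym2.mem_iff.1 this with h | h <;>
          exact hu (h ▸ Finset.mem_image_of_mem u' (Finset.mem_univ _))
      rw [hV, hE, Finset.card_insert_of_notMem hu, Finset.card_insert_of_notMem hnot]
      omega

lemma edgeCount_eq_zero_iff {V : Type*} [DecidableEq V] {n : ℕ} (u : Fin (n + 1) → V) (e : Sym2 V) :
    edgeCount u e = 0 ↔ e ∉ Finset.univ.image (walkEdge u) := by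
  simp [edgeCount, Finset.filter_eq_empty_iff]

section Walks

variable {V : Type*} [Fintype V] [DecidableEq V]

/-- The arbitrary endpoint weight `F` is what makes the induction close: the first step of the walk
is absorbed into a new weight. -/
lemma sum_walk_mul_prod (M : Matrix V V ℝ) (n : ℕ) : ∀ F : V → V → ℝ,
    ∑ u : Fin (n + 1) → V, F (u 0) (u (Fin.last n)) * ∏ i : Fin n, M (u i.castSucc) (u i.succ) =
      ∑ i, ∑ j, F i j * (M ^ n) i j := by
  induction n with
  | zero =>
    intro F
    rw [← (Equiv.funUnique (Fin 1) V).symm.sum_comp]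
    simp [Matrix.one_apply]
  | succ n ih =>
    intro F
    rw [← (Fin.consEquiv fun _ : Fin (n + 2) => V).sum_comp, Fintype.sum_prod_type,
      Finset.sum_comm]
    have := ih fun b l => ∑ a, F a l * M a b
    calc _ = ∑ u : Fin (n + 1) → V, (∑ a, F a (u (Fin.last n)) * M a (u 0)) *
          ∏ i : Fin n, M (u i.castSucc) (u i.succ) := by
          refine Finset.sum_congr rfl fun u _ => ?_
          rw [Finset.sum_mul]
          refine Finset.sum_congr rfl fun a _ => ?_
          simp only [Fin.consEquiv, Equiv.coe_fn_mk, Fin.prod_univ_succ, Fin.cons_zero,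
            Fin.castSucc_zero, Fin.cons_succ, ← Fin.succ_castSucc, ← Fin.succ_last]
          ring
      _ = ∑ b, ∑ l, (∑ a, F a l * M a b) * (M ^ n) b l := this
      _ = ∑ a, ∑ l, F a l * (M ^ (n + 1)) a l := by
          simp only [pow_succ', Matrix.mul_apply, Finset.mul_sum, Finset.sum_mul]
          rw [Finset.sum_comm]
          rw [Finset.sum_comm (s := Finset.univ (α := V)) (t := Finset.univ (α := V))
            (f := fun a l => ∑ b, F a l * (M a b * (M ^ n) b l))]
          refine Finset.sum_congr rfl fun l _ => ?_
          rw [Finset.sum_comm]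
          refine Finset.sum_congr rfl fun a _ => Finset.sum_congr rfl fun b _ => ?_
          ring

lemma trace_pow_eq_sum_walks (M : Matrix V V ℝ) (n : ℕ) :
    (M ^ n).trace = ∑ u : Fin (n + 1) → V with u 0 = u (Fin.last n),
      ∏ i : Fin n, M (u i.castSucc) (u i.succ) := by
  have := sum_walk_mul_prod M n fun i j => if i = j then 1 else 0
  rw [Finset.sum_filter]
  simp only [ite_mul, one_mul, zero_mul, Finset.sum_ite_eq, Finset.mem_univ, if_true] at this
  rw [this]
  rfl

lemma prod_walkEdge {n : ℕ} (u : Fin (n + 1) → V) (f : Sym2 V → ℝ) :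
    ∏ i, f (walkEdge u i) = ∏ e, f e ^ edgeCount u e := by
  rw [← Finset.prod_fiberwise Finset.univ (walkEdge u)]
  refine Finset.prod_congr rfl fun e _ => ?_
  rw [Finset.prod_congr rfl (g := fun _ => f e) fun i hi => by rw [(Finset.mem_filter.1 hi).2],
    Finset.prod_const, edgeCount]

lemma expected_trace_pow {Ω : Type*} [Fintype Ω] (μ : Ω → ℝ) (h : Ω → ℝ) (n : ℕ) :
    ∑ ω : Sym2 V → Ω, prodWeight μ ω * ((symMatrix fun e => h (ω e)) ^ n).trace =
      ∑ u : Fin (n + 1) → V with u 0 = u (Fin.last n),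
        ∏ e, ∑ x, μ x * h x ^ edgeCount u e := by
  simp only [trace_pow_eq_sum_walks, Finset.mul_sum]
  rw [Finset.sum_comm]
  refine Finset.sum_congr rfl fun u _ => ?_
  rw [← sum_prodWeight_mul_prod μ fun e x => h x ^ edgeCount u e]
  refine Finset.sum_congr rfl fun ω _ => ?_
  rw [← prod_walkEdge u fun e => h (ω e)]
  rfl

open Classical in
-- By independence the mean of a walk factorises over edges. An edge used an odd number of times
-- kills it; otherwise each distinct edge contributes `q ≤ 1`, and there are at least as many
-- distinct edges as distinct vertices minus one.
lemma expected_trace_pow_le {Ω : Type*} [Fintype Ω] (μ : Ω → ℝ) (h : Ω → ℝ) {q : ℝ}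
    (hq : q ∈ Set.Icc (0 : ℝ) 1) (h0 : ∑ x, μ x = 1) (hodd : ∀ j, Odd j → ∑ x, μ x * h x ^ j = 0)
    (heven : ∀ j, Even j → j ≠ 0 → ∑ x, μ x * h x ^ j = q) (n : ℕ) :
    ∑ ω : Sym2 V → Ω, prodWeight μ ω * ((symMatrix fun e => h (ω e)) ^ n).trace ≤
      ∑ u : Fin (n + 1) → V with IsEvenWalk u, q ^ ((Finset.univ.image u).card - 1) := by
  rw [expected_trace_pow]
  have hsub : (Finset.univ.filter fun u : Fin (n + 1) → V => IsEvenWalk u) ⊆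
      Finset.univ.filter fun u : Fin (n + 1) → V => u 0 = u (Fin.last n) := by
    intro u hu
    simp only [Finset.mem_filter, Finset.mem_univ, true_and] at hu ⊢
    exact hu.1
  rw [← Finset.sum_subset hsub]
  · refine Finset.sum_le_sum fun u hu => ?_
    have hu := (Finset.mem_filter.1 hu).2
    have : ∀ e, ∑ x, μ x * h x ^ edgeCount u e =
        if e ∈ Finset.univ.image (walkEdge u) then q else 1 := fun e => by
      split_ifs with he
      · exact heven _ (hu.2 e) fun h' => (edgeCount_eq_zero_iff u e).1 h' he
      · rw [(edgeCount_eq_zero_iff u e).2 he]; simpa using h0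
    rw [Finset.prod_congr rfl fun e _ => this e, Finset.prod_ite_mem, Finset.univ_inter,
      Finset.prod_const]
    refine pow_le_pow_of_le_one hq.1 hq.2 ?_
    have := card_image_le_card_edges u
    omega
  · intro u hu hu'
    simp only [Finset.mem_filter, Finset.mem_univ, true_and] at hu hu'
    have : ∃ e, ¬ Even (edgeCount u e) := by
      by_contra! hcon
      exact hu' ⟨hu, hcon⟩
    obtain ⟨e, he⟩ := this
    exact Finset.prod_eq_zero (Finset.mem_univ e) (hodd _ (Nat.not_even_iff_odd.1 he))

open Classical in
lemma expected_trace_pow_sign {Ω : Type*} [Fintype Ω] (μ : Ω → ℝ) (h : Ω → ℝ)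
    (hodd : ∀ j, Odd j → ∑ x, μ x * h x ^ j = 0)
    (heven : ∀ j, Even j → ∑ x, μ x * h x ^ j = 1) (n : ℕ) :
    ∑ ω : Sym2 V → Ω, prodWeight μ ω * ((symMatrix fun e => h (ω e)) ^ n).trace =
      (Finset.univ.filter fun u : Fin (n + 1) → V => IsEvenWalk u).card := by
  rw [expected_trace_pow]
  have hsub : (Finset.univ.filter fun u : Fin (n + 1) → V => IsEvenWalk u) ⊆
      Finset.univ.filter fun u : Fin (n + 1) → V => u 0 = u (Fin.last n) := by
    intro u hu
    simp only [Finset.mem_filter, Finset.mem_univ, true_and] at hu ⊢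
    exact hu.1
  rw [← Finset.sum_subset hsub]
  · rw [Finset.card_eq_sum_ones, Nat.cast_sum]
    refine Finset.sum_congr rfl fun u hu => ?_
    have hu := (Finset.mem_filter.1 hu).2
    rw [Finset.prod_congr rfl fun e _ => heven _ (hu.2 e)]
    simp
  · intro u hu hu'
    simp only [Finset.mem_filter, Finset.mem_univ, true_and] at hu hu'
    have : ∃ e, ¬ Even (edgeCount u e) := by
      by_contra! hcon
      exact hu' ⟨hu, hcon⟩
    obtain ⟨e, he⟩ := this
    exact Finset.prod_eq_zero (Finset.mem_univ e) (hodd _ (Nat.not_even_iff_odd.1 he))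

end Walks

/-! ### Comparing even walks on two vertex sets -/

section Kernels

variable {X V W : Type*} [Fintype X]

lemma card_image_le_of_kernel [DecidableEq V] [DecidableEq W] [Nonempty X] {u : X → V} {w : X → W}
    (h : ∀ i j, u i = u j → w i = w j) :
    (Finset.univ.image w).card ≤ (Finset.univ.image u).card := by
  obtain ⟨x⟩ := ‹Nonempty X›
  have hf : Function.FactorsThrough w u := fun i j hij => h i j hij
  have : Finset.univ.image w = (Finset.univ.image u).image (Function.extend u w fun _ => w x) := by
    rw [Finset.image_image]
    refine Finset.image_congr fun i _ => ?_
    exact (hf.extend_apply _ i).symm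
  rw [this]
  exact Finset.card_image_le

open Classical in
-- A map with the same coincidences as `u` is an injective relabelling of the values of `u`.
lemma card_same_kernel [Fintype W] (u : X → V) :
    (Finset.univ.filter fun w : X → W => ∀ i j, u i = u j ↔ w i = w j).card =
      (Fintype.card W).descFactorial (Finset.univ.image u).card := by
  rw [← Fintype.card_subtype, ← Fintype.card_coe (Finset.univ.image u), ← Fintype.card_embedding_eq]
  symm
  let Φ : ((Finset.univ.image u : Finset V) ↪ W) → {w : X → W // ∀ i j, u i = u j ↔ w i = w j} :=
    fun f => ⟨fun x => f ⟨u x, Finset.mem_image_of_mem u (Finset.mem_univ x)⟩, fun i j => by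
      rw [f.injective.eq_iff, Subtype.mk.injEq]⟩
  refine Fintype.card_of_bijective (f := Φ) ⟨fun f g hfg => ?_, fun w => ?_⟩
  · ext ⟨v, hv⟩
    obtain ⟨x, -, rfl⟩ := Finset.mem_image.1 hv
    exact congrFun (congrArg Subtype.val hfg) x
  · have hc : ∀ v : (Finset.univ.image u : Finset V), ∃ x, u x = v := fun v => by
      obtain ⟨x, -, hx⟩ := Finset.mem_image.1 v.2
      exact ⟨x, hx⟩
    choose c hc using hc
    refine ⟨⟨fun v => w.1 (c v), fun v v' h => ?_⟩, ?_⟩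
    · have := (w.2 _ _).2 h
      rw [hc, hc] at this
      exact Subtype.ext this
    · refine Subtype.ext (funext fun x => ?_)
      exact (w.2 _ _).1 (hc _)

end Kernels

lemma isEvenWalk_of_kernel {V W : Type*} [DecidableEq V] [DecidableEq W] {n : ℕ}
    {u : Fin (n + 1) → V} {w : Fin (n + 1) → W} (h : ∀ i j, u i = u j ↔ w i = w j)
    (hu : IsEvenWalk u) : IsEvenWalk w := by
  refine ⟨(h _ _).1 hu.1, fun e => ?_⟩
  by_cases he : ∃ i, walkEdge w i = e
  · obtain ⟨i, rfl⟩ := he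
    convert hu.2 (walkEdge u i) using 1
    unfold edgeCount
    congr 1
    refine Finset.filter_congr fun j _ => ?_
    simp only [walkEdge, Sym2.eq_iff, h]
  · push Not at he
    have : edgeCount w e = 0 := by
      simpa [edgeCount, Finset.filter_eq_empty_iff] using he
    rw [this]
    exact Even.zero

/-- With `m` distinct vertices, this compares one coincidence pattern in the two vertex sets. It
follows from `(N)_m ≤ N ^ m` and `(r)_m ≥ r * (r - n) ^ (m - 1)`. -/
lemma descFactorial_mul_pow_le {N r m n : ℕ} {q : ℝ} (hq : 0 ≤ q) (hm1 : 1 ≤ m) (hm : m ≤ n + 1)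
    (hn : n < r) (hN : N * q ≤ r - n) :
    (N.descFactorial m : ℝ) * q ^ (m - 1) * r ≤ N * r.descFactorial m := by
  obtain ⟨m, rfl⟩ : ∃ k, m = k + 1 := ⟨m - 1, by omega⟩
  have h1 : (N.descFactorial (m + 1) : ℝ) ≤ N ^ (m + 1) := by
    exact_mod_cast Nat.descFactorial_le_pow N (m + 1)
  have h2 : (r : ℝ) * (r - n) ^ m ≤ r.descFactorial (m + 1) := by
    obtain ⟨r, rfl⟩ : ∃ k, r = k + 1 := ⟨r - 1, by omega⟩
    rw [Nat.succ_descFactorial_succ]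
    have h3 := Nat.pow_sub_le_descFactorial r m
    have h4 : ((r + 1 : ℕ) : ℝ) - n ≤ ((r + 1 - m : ℕ) : ℝ) := by
      rw [Nat.cast_sub (by omega)]
      have : (m : ℝ) ≤ n := by exact_mod_cast (by omega : m ≤ n)
      linarith
    have h5 : (0 : ℝ) ≤ ((r + 1 : ℕ) : ℝ) - n := by
      have : (n : ℝ) ≤ ((r + 1 : ℕ) : ℝ) := by exact_mod_cast hn.le
      linarith
    push_cast [Nat.cast_mul]
    gcongr
    calc _ ≤ ((r + 1 - m : ℕ) : ℝ) ^ m := by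
          refine pow_le_pow_left₀ (by exact_mod_cast h5) (by exact_mod_cast h4) _
      _ ≤ _ := by exact_mod_cast h3
  have h6 : ((N : ℝ) * q) ^ m ≤ (r - n) ^ m := by gcongr
  simp only [Nat.add_sub_cancel]
  calc (N.descFactorial (m + 1) : ℝ) * q ^ m * r ≤ N ^ (m + 1) * q ^ m * r := by gcongr
    _ = N * (r * ((N : ℝ) * q) ^ m) := by rw [mul_pow]; ring
    _ ≤ N * (r * (r - n) ^ m) := by gcongr
    _ ≤ _ := by gcongr

lemma card_image_fin_le {T : Type*} [DecidableEq T] {n : ℕ} (u : Fin (n + 1) → T) :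
    (Finset.univ.image u).card ≤ n + 1 :=
  Finset.card_image_le.trans (by simp)

lemma one_le_card_image_fin {T : Type*} [DecidableEq T] {n : ℕ} (u : Fin (n + 1) → T) :
    1 ≤ (Finset.univ.image u).card :=
  Finset.card_pos.2 (Finset.univ_nonempty.image u)

open Classical in
/-- Comparison of weighted even walks in `V` with even walks in a smaller set `W`. -/
theorem sum_even_walks_le {V W : Type*} [Fintype V] [Fintype W] {n : ℕ} {q : ℝ} (hq : 0 ≤ q)
    (hn : n < Fintype.card W) (hN : Fintype.card V * q ≤ Fintype.card W - n) :
    (∑ u : Fin (n + 1) → V with IsEvenWalk u, q ^ ((Finset.univ.image u).card - 1)) *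
        Fintype.card W ≤
      Fintype.card V * (Finset.univ.filter fun w : Fin (n + 1) → W => IsEvenWalk w).card := by
  set r := Fintype.card W
  set N := Fintype.card V
  have hD : ∀ m ≤ n + 1, (0 : ℝ) < r.descFactorial m := fun m h => by
    have : r.descFactorial m ≠ 0 := by
      rw [Ne, Nat.descFactorial_eq_zero_iff_lt]; omega
    positivity
  set K : (Fin (n + 1) → V) → (Fin (n + 1) → W) → Prop := fun u w => ∀ i j, u i = u j ↔ w i = w j
  -- Double counting over pairs of walks with equal kernels: `c m` spreads the weight of `u` evenly
  -- over its `(r)_m` partners `w`, and each even `w` then receives at most `N`.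
  set c : ℕ → ℝ := fun m => q ^ (m - 1) * r / r.descFactorial m
  calc (∑ u : Fin (n + 1) → V with IsEvenWalk u, q ^ ((Finset.univ.image u).card - 1)) * r
      = ∑ u : Fin (n + 1) → V, ∑ w : Fin (n + 1) → W,
        if IsEvenWalk u ∧ K u w then c (Finset.univ.image u).card else 0 := by
        rw [Finset.sum_mul, Finset.sum_filter]
        refine Finset.sum_congr rfl fun u _ => ?_
        have hcard : (Finset.univ.filter fun w : Fin (n + 1) → W => K u w).card =
            r.descFactorial (Finset.univ.image u).card := by
          convert card_same_kernel (W := W) u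
        split_ifs with hu
        · simp only [hu, true_and]
          rw [← Finset.sum_filter, Finset.sum_const, hcard, nsmul_eq_mul]
          have := (hD _ (card_image_fin_le u)).ne'
          simp only [c]
          field_simp
        · simp [hu]
    _ = ∑ w : Fin (n + 1) → W, ∑ u : Fin (n + 1) → V,
        if IsEvenWalk u ∧ K u w then c (Finset.univ.image u).card else 0 := Finset.sum_comm
    _ ≤ ∑ w : Fin (n + 1) → W, if IsEvenWalk w then (N : ℝ) else 0 := by
        refine Finset.sum_le_sum fun w _ => ?_
        split_ifs with hw
        · have : ∀ u : Fin (n + 1) → V, (if IsEvenWalk u ∧ K u w then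
              c (Finset.univ.image u).card else 0) =
              if (∀ i j, w i = w j ↔ u i = u j) then c (Finset.univ.image w).card else 0 :=
            fun u => by
              by_cases hk : K u w
              · have hk' : ∀ i j, w i = w j ↔ u i = u j := fun i j => (hk i j).symm
                rw [if_pos ⟨isEvenWalk_of_kernel hk' hw, hk⟩, if_pos hk']
                congr 1
                exact le_antisymm (card_image_le_of_kernel fun i j => (hk' i j).1)
                  (card_image_le_of_kernel fun i j => (hk i j).1)
              · rw [if_neg fun h => hk h.2, if_neg fun h => hk fun i j => (h i j).symm]
          have hcard : (Finset.univ.filter fun u : Fin (n + 1) → V =>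
              ∀ i j, w i = w j ↔ u i = u j).card =
              N.descFactorial (Finset.univ.image w).card := by
            convert card_same_kernel (W := V) w
          rw [Finset.sum_congr rfl fun u _ => this u, ← Finset.sum_filter, Finset.sum_const,
            hcard, nsmul_eq_mul]
          simp only [c]
          rw [← mul_div_assoc, div_le_iff₀ (hD _ (card_image_fin_le w)), ← mul_assoc]
          exact descFactorial_mul_pow_le hq (one_le_card_image_fin w) (card_image_fin_le w) hn hN
        · refine (Finset.sum_eq_zero fun u _ => ?_).le
          rw [if_neg]
          rintro ⟨hu, hk⟩
          exact hw (isEvenWalk_of_kernel hk hu)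
    _ = _ := by
        rw [← Finset.sum_filter, Finset.sum_const, nsmul_eq_mul, mul_comm]

lemma isHermitian_symMatrix {V : Type*} (x : Sym2 V → ℝ) : (symMatrix x).IsHermitian := by
  ext i j
  simp [symMatrix, Sym2.eq_swap]

/-! ### Operator norms through traces and nets -/

section Norms

variable {V : Type*} [Fintype V] [DecidableEq V]

lemma Matrix.IsHermitian.norm_pow_le_trace_pow {M : Matrix V V ℝ} (hM : M.IsHermitian) {k : ℕ}
    (hk : k ≠ 0) : ‖M‖ ^ (2 * k) ≤ (M ^ (2 * k)).trace := by
  set D : Matrix V V ℝ := Matrix.diagonal (RCLike.ofReal ∘ hM.eigenvalues)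
  have hsp : M = Unitary.conjStarAlgAut ℝ _ hM.eigenvectorUnitary D := hM.spectral_theorem
  have hnorm : ‖M‖ = ‖hM.eigenvalues‖ := by
    rw [show ‖M‖ = _ from congrArg norm hsp, Unitary.conjStarAlgAut_apply, mul_assoc,
      CStarRing.norm_coe_unitary_mul,
      ← Unitary.coe_star, CStarRing.norm_mul_coe_unitary, Matrix.l2_opNorm_diagonal]
    rfl
  have htr : (M ^ (2 * k)).trace = ∑ i, hM.eigenvalues i ^ (2 * k) := by
    rw [show (M ^ (2 * k)).trace = _ from congrArg (fun X => (X ^ (2 * k)).trace) hsp]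
    rw [← map_pow, Unitary.conjStarAlgAut_apply, mul_assoc, Matrix.trace_mul_comm, mul_assoc]
    simp [D, Matrix.diagonal_pow, Matrix.trace_diagonal]
  rw [hnorm, htr]
  have hpos : ∀ i, 0 ≤ hM.eigenvalues i ^ (2 * k) := fun i => (even_two_mul k).pow_nonneg _
  rcases isEmpty_or_nonempty V with hV | hV
  · have : hM.eigenvalues = 0 := Subsingleton.elim _ _
    simp [this, hk]
  · obtain ⟨i, -, hi⟩ := Finset.exists_max_image Finset.univ (fun i => ‖hM.eigenvalues i‖)
      Finset.univ_nonempty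
    have : ‖hM.eigenvalues‖ ≤ ‖hM.eigenvalues i‖ :=
      (pi_norm_le_iff_of_nonneg (norm_nonneg _)).2 fun j => hi j (Finset.mem_univ j)
    calc ‖hM.eigenvalues‖ ^ (2 * k) ≤ ‖hM.eigenvalues i‖ ^ (2 * k) := by gcongr
      _ = hM.eigenvalues i ^ (2 * k) := by rw [Real.norm_eq_abs, (even_two_mul k).pow_abs]
      _ ≤ _ := Finset.single_le_sum (fun i _ => hpos i) (Finset.mem_univ i)

lemma Matrix.abs_inner_le_norm (M : Matrix V V ℝ) (x y : EuclideanSpace ℝ V) :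
    |∑ i, ∑ j, x i * M i j * y j| ≤ ‖M‖ * ‖x‖ * ‖y‖ := by
  have h : ∑ i, ∑ j, x i * M i j * y j = ⟪x, Matrix.toEuclideanCLM (𝕜 := ℝ) M y⟫ := by
    rw [Matrix.inner_toEuclideanCLM]
    simp [dotProduct, Matrix.mulVec, Finset.mul_sum, mul_assoc]
  rw [h]
  calc _ ≤ ‖x‖ * ‖Matrix.toEuclideanCLM (𝕜 := ℝ) M y‖ := abs_real_inner_le_norm _ _
    _ ≤ ‖x‖ * (‖M‖ * ‖y‖) := by
      gcongr
      exact (Matrix.toEuclideanCLM (𝕜 := ℝ) M).le_opNorm y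
    _ = _ := by ring

lemma Matrix.trace_le_card_mul_norm (M : Matrix V V ℝ) : M.trace ≤ Fintype.card V * ‖M‖ := by
  have : ∀ i, M i i ≤ ‖M‖ := fun i => by
    have := Matrix.abs_inner_le_norm M (EuclideanSpace.single i 1) (EuclideanSpace.single i 1)
    simp only [PiLp.norm_single, norm_one, mul_one] at this
    refine le_trans (le_of_eq ?_) ((le_abs_self _).trans this)
    simp
  refine (Finset.sum_le_sum fun i _ => this i).trans ?_
  simp

/-- A `1/2`-net of the unit sphere of Euclidean space with at most `5 ^ dim` points. -/
lemma exists_half_net (E : Type*) [NormedAddCommGroup E] [NormedSpace ℝ E]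
    [FiniteDimensional ℝ E] : ∃ S : Finset E, S.card ≤ 5 ^ Module.finrank ℝ E ∧
      (∀ x ∈ S, ‖x‖ = 1) ∧ ∀ x, ‖x‖ = 1 → ∃ y ∈ S, ‖x - y‖ ≤ 1 / 2 := by
  classical
  set P : Finset E → Prop := fun S => (∀ x ∈ S, ‖x‖ = 1) ∧
    ∀ x ∈ S, ∀ y ∈ S, x ≠ y → 1 / 2 < ‖x - y‖
  have hcard : ∀ S, P S → S.card ≤ 5 ^ Module.finrank ℝ E := fun S hS => by
    -- Doubling turns a `1/2`-separated subset of the unit sphere into a `1`-separated subset of the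
    -- ball of radius `2`, as the Besicovitch counting bound requires.
    have hinj : Function.Injective fun x : E => (2 : ℝ) • x := smul_right_injective E two_ne_zero
    rw [← Finset.card_image_of_injective S hinj]
    refine Besicovitch.card_le_of_separated _ ?_ ?_
    · intro c hc
      obtain ⟨x, hx, rfl⟩ := Finset.mem_image.1 hc
      simp [norm_smul, hS.1 x hx]
    · intro c hc d hd hcd
      obtain ⟨x, hx, rfl⟩ := Finset.mem_image.1 hc
      obtain ⟨y, hy, rfl⟩ := Finset.mem_image.1 hd
      have := hS.2 x hx y hy fun h => hcd (by rw [h])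
      rw [← smul_sub, norm_smul]
      norm_num
      linarith
  -- A separated set of maximal cardinality is a net: any uncovered unit vector could be added to
  -- it.
  set Q : ℕ → Prop := fun k => ∃ S, P S ∧ S.card = k
  have h0 : Q 0 := ⟨∅, ⟨by simp, by simp⟩, rfl⟩
  obtain ⟨S, hS, hSc⟩ := Nat.findGreatest_spec (P := Q) (Nat.zero_le (5 ^ Module.finrank ℝ E)) h0
  refine ⟨S, hcard S hS, hS.1, fun x hx => ?_⟩
  by_contra! hcon
  have hxS : x ∉ S := fun h => by
    have := hcon x h
    norm_num at this
  have hP : P (insert x S) := by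
    refine ⟨fun y hy => ?_, fun y hy z hz hyz => ?_⟩
    · rcases Finset.mem_insert.1 hy with rfl | hy
      exacts [hx, hS.1 y hy]
    · rcases Finset.mem_insert.1 hy with hyx | hy' <;>
        rcases Finset.mem_insert.1 hz with hzx | hz'
      · exact absurd (hyx.trans hzx.symm) hyz
      · rw [hyx]; exact hcon z hz'
      · rw [hzx, norm_sub_rev]; exact hcon y hy'
      · exact hS.2 y hy' z hz' hyz
  have := Nat.le_findGreatest (P := Q) (hcard _ hP) ⟨_, hP, rfl⟩
  rw [Finset.card_insert_of_notMem hxS] at this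
  omega

lemma norm_le_two_mul_inner {E : Type*} [NormedAddCommGroup E] [InnerProductSpace ℝ E]
    {S : Finset E} (hne : S.Nonempty)
    (hS : ∀ x : E, ‖x‖ = 1 → ∃ y ∈ S, ‖x - y‖ ≤ 1 / 2) (v : E) :
    ∃ y ∈ S, ‖v‖ ≤ 2 * |⟪y, v⟫| := by
  by_cases hv : v = 0
  · obtain ⟨y, hy⟩ := hne
    exact ⟨y, hy, by simp [hv]⟩
  · have hv' : ‖v‖ ≠ 0 := norm_ne_zero_iff.2 hv
    obtain ⟨y, hy, hyv⟩ := hS (‖v‖⁻¹ • v) (by simp [norm_smul, hv'])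
    refine ⟨y, hy, ?_⟩
    have h1 : ⟪‖v‖⁻¹ • v, v⟫ = ‖v‖ := by
      rw [real_inner_smul_left, real_inner_self_eq_norm_sq]
      field_simp
    have h2 : ⟪‖v‖⁻¹ • v - y, v⟫ ≤ 1 / 2 * ‖v‖ :=
      (real_inner_le_norm _ _).trans (by gcongr)
    rw [inner_sub_left, h1] at h2
    linarith [le_abs_self ⟪y, v⟫]

/-- Each of the two arguments of the bilinear form is moved to the net at the cost of a factor `2`.
-/
lemma opNorm_le_four_mul_inner {E : Type*} [NormedAddCommGroup E] [InnerProductSpace ℝ E]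
    {S : Finset E} (hne : S.Nonempty)
    (hS : ∀ x : E, ‖x‖ = 1 → ∃ y ∈ S, ‖x - y‖ ≤ 1 / 2) (T : E →L[ℝ] E) :
    ∃ x ∈ S, ∃ y ∈ S, ‖T‖ ≤ 4 * |⟪x, T y⟫| := by
  obtain ⟨⟨x, y⟩, hxy, hmax⟩ := Finset.exists_max_image (S ×ˢ S)
    (fun z => |⟪z.1, T z.2⟫|) (hne.product hne)
  obtain ⟨hx, hy⟩ := Finset.mem_product.1 hxy
  refine ⟨x, hx, y, hy, ?_⟩
  set m := |⟪x, T y⟫|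
  have hnet : ∀ z ∈ S, ‖T z‖ ≤ 2 * m := fun z hz => by
    obtain ⟨w, hw, hle⟩ := norm_le_two_mul_inner hne hS (T z)
    have := hmax (w, z) (Finset.mem_product.2 ⟨hw, hz⟩)
    exact hle.trans (by gcongr)
  have hm : 0 ≤ m := abs_nonneg _
  have : ‖T‖ ≤ 2 * m + ‖T‖ * (1 / 2) := by
    refine T.opNorm_le_bound (by positivity) fun v => ?_
    by_cases hv : v = 0
    · simp [hv]
    have hv' : ‖v‖ ≠ 0 := norm_ne_zero_iff.2 hv
    obtain ⟨z, hz, hzv⟩ := hS (‖v‖⁻¹ • v) (by simp [norm_smul, hv'])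
    have h1 : ‖T (‖v‖⁻¹ • v)‖ ≤ 2 * m + ‖T‖ * (1 / 2) := by
      calc ‖T (‖v‖⁻¹ • v)‖ = ‖T z + T (‖v‖⁻¹ • v - z)‖ := by rw [← map_add]; congr 2; abel
        _ ≤ ‖T z‖ + ‖T (‖v‖⁻¹ • v - z)‖ := norm_add_le _ _
        _ ≤ 2 * m + ‖T‖ * (1 / 2) := by
          gcongr
          · exact hnet z hz
          · exact (T.le_opNorm _).trans (by gcongr)
    rw [map_smul, norm_smul, norm_inv, norm_norm, inv_mul_le_iff₀ (by positivity)] at h1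
    linarith
  linarith

end Norms

/-! ### Bilinear forms and random sign matrices -/

section Pairs

variable {V : Type*} [Fintype V] [DecidableEq V]

lemma card_pairs_le_two (e : Sym2 V) :
    (Finset.univ.filter fun z : V × V => s(z.1, z.2) = e).card ≤ 2 := by
  induction e with
  | _ a b =>
    refine (Finset.card_le_card (t := {(a, b), (b, a)}) fun z hz => ?_).trans Finset.card_le_two
    have := (Finset.mem_filter.1 hz).2
    rw [Sym2.eq_iff] at this
    simp only [Finset.mem_insert, Finset.mem_singleton, Prod.ext_iff]
    exact this

lemma sum_sum_sym2_le (F : Sym2 V → ℝ) (hF : ∀ e, 0 ≤ F e) :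
    ∑ i, ∑ j, F s(i, j) ≤ 2 * ∑ e, F e := by
  rw [← Fintype.sum_prod_type' fun i j => F s(i, j),
    ← Finset.sum_fiberwise Finset.univ (fun z : V × V => s(z.1, z.2)), Finset.mul_sum]
  refine Finset.sum_le_sum fun e _ => ?_
  rw [Finset.sum_congr rfl (g := fun _ => F e) fun z hz => by rw [(Finset.mem_filter.1 hz).2],
    Finset.sum_const, nsmul_eq_mul]
  have : ((Finset.univ.filter fun z : V × V => s(z.1, z.2) = e).card : ℝ) ≤ 2 := by
    exact_mod_cast card_pairs_le_two e
  exact mul_le_mul_of_nonneg_right this (hF e)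

/-- The coefficient of `h e` in the bilinear form of `symMatrix h`. -/
noncomputable def pairCoeff (x y : EuclideanSpace ℝ V) (e : Sym2 V) : ℝ :=
  ∑ z : V × V with s(z.1, z.2) = e, x z.1 * y z.2

lemma bilin_symMatrix (x y : EuclideanSpace ℝ V) (h : Sym2 V → ℝ) :
    ⟪x, Matrix.toEuclideanCLM (𝕜 := ℝ) (symMatrix h) y⟫ = ∑ e, h e * pairCoeff x y e := by
  rw [Matrix.inner_toEuclideanCLM]
  simp only [dotProduct, Matrix.mulVec, Finset.mul_sum, pairCoeff]
  rw [← Fintype.sum_prod_type' fun i j => x i * (symMatrix h i j * y j),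
    ← Finset.sum_fiberwise Finset.univ (fun z : V × V => s(z.1, z.2))]
  refine Finset.sum_congr rfl fun e _ => Finset.sum_congr rfl fun z hz => ?_
  rw [← (Finset.mem_filter.1 hz).2]
  simp only [symMatrix, Matrix.of_apply]
  ring

/-- An unordered pair carries at most two ordered ones, so Cauchy–Schwarz loses a factor `2` against
`‖x‖² * ‖y‖² = 1`. -/
lemma sum_pairCoeff_sq_le (x y : EuclideanSpace ℝ V) (hx : ‖x‖ = 1) (hy : ‖y‖ = 1) :
    ∑ e, pairCoeff x y e ^ 2 ≤ 2 := by
  have h1 : ∀ e, pairCoeff x y e ^ 2 ≤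
      2 * ∑ z : V × V with s(z.1, z.2) = e, (x z.1 * y z.2) ^ 2 := fun e => by
    refine sq_sum_le_card_mul_sum_sq.trans ?_
    have : ((Finset.univ.filter fun z : V × V => s(z.1, z.2) = e).card : ℝ) ≤ 2 := by
      exact_mod_cast card_pairs_le_two e
    exact mul_le_mul_of_nonneg_right this (Finset.sum_nonneg fun _ _ => sq_nonneg _)
  refine (Finset.sum_le_sum fun e _ => h1 e).trans ?_
  rw [← Finset.mul_sum, Finset.sum_fiberwise Finset.univ (fun z : V × V => s(z.1, z.2)),
    Fintype.sum_prod_type]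
  simp only [mul_pow, ← Finset.mul_sum, ← Finset.sum_mul]
  have hx2 := EuclideanSpace.real_norm_sq_eq x
  have hy2 := EuclideanSpace.real_norm_sq_eq y
  rw [← hx2, ← hy2, hx, hy]
  norm_num

end Pairs

/-- The sign given by a Boolean. -/
noncomputable def boolSign (b : Bool) : ℝ := if b then 1 else -1

lemma sum_half_boolSign_odd (j : ℕ) (hj : Odd j) :
    ∑ b, bernoulliWeight (1 / 2) b * boolSign b ^ j = 0 := by
  simp [bernoulliWeight, boolSign, hj.neg_one_pow]
  norm_num

lemma sum_half_boolSign_even (j : ℕ) (hj : Even j) :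
    ∑ b, bernoulliWeight (1 / 2) b * boolSign b ^ j = 1 := by
  simp [bernoulliWeight, boolSign, hj.neg_one_pow]

section SignMatrix

variable {E : Type*} [Fintype E] [DecidableEq E]

lemma sign_exp_moment (c : E → ℝ) {s : ℝ} (hc : ∑ e, c e ^ 2 ≤ s) :
    ∑ ω : E → Bool, prodWeight (bernoulliWeight (1 / 2)) ω *
      Real.exp (∑ e, boolSign (ω e) * c e) ≤ Real.exp (s / 2) := by
  simp only [Real.exp_sum]
  rw [sum_prodWeight_mul_prod (bernoulliWeight (1 / 2)) fun e b => Real.exp (boolSign b * c e)]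
  have : ∀ e, ∑ b, bernoulliWeight (1 / 2) b * Real.exp (boolSign b * c e) ≤
      Real.exp (c e ^ 2 / 2) := fun e => by
    refine le_trans (le_of_eq ?_) (Real.cosh_le_exp_half_sq (c e))
    rw [Real.cosh_eq]
    simp [bernoulliWeight, boolSign]
    ring
  calc _ ≤ ∏ e, Real.exp (c e ^ 2 / 2) := by
        refine Finset.prod_le_prod (fun e _ => Finset.sum_nonneg fun b _ => ?_) fun e _ => this e
        exact mul_nonneg (bernoulliWeight_nonneg ⟨by norm_num, by norm_num⟩ b) (Real.exp_pos _).le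
    _ = Real.exp ((∑ e, c e ^ 2) / 2) := by
        rw [← Real.exp_sum, Finset.sum_div]
    _ ≤ _ := by gcongr

/-- The sum is subgaussian with variance proxy `2`. Exponential moments at `±√k` dominate the
`2k`-th power, and `4 * exp 1 ≤ 12` gives the constant. -/
lemma sign_moment (c : E → ℝ) (hc : ∑ e, c e ^ 2 ≤ 2) {k : ℕ} (hk : 1 ≤ k) :
    ∑ ω : E → Bool, prodWeight (bernoulliWeight (1 / 2)) ω *
      |∑ e, boolSign (ω e) * c e| ^ (2 * k) ≤ 2 * (12 * k) ^ k := by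
  have hw := prodWeight_nonneg (E := E)
    (bernoulliWeight_nonneg (p := 1 / 2) ⟨by norm_num, by norm_num⟩)
  have hk0 : (0 : ℝ) < k := by exact_mod_cast hk
  have hmom : ∀ l : ℝ, l ^ 2 = k → ∑ ω : E → Bool, prodWeight (bernoulliWeight (1 / 2)) ω *
      Real.exp (l * ∑ e, boolSign (ω e) * c e) ≤ Real.exp k := fun l hl => by
    have := sign_exp_moment (fun e => l * c e) (s := 2 * k) (by
      simp only [mul_pow, ← Finset.mul_sum, hl]
      nlinarith)
    rw [mul_div_cancel_left₀ _ two_ne_zero] at this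
    refine le_trans (le_of_eq (Finset.sum_congr rfl fun ω _ => ?_)) this
    rw [Finset.mul_sum]
    congr 2
    exact Finset.sum_congr rfl fun e _ => by ring
  have hs : √(k : ℝ) ^ 2 = k := Real.sq_sqrt hk0.le
  have h1 := hmom (√k) hs
  have h2 := hmom (-√k) (by rw [neg_sq, hs])
  have hpt : ∀ z : ℝ, |z| ^ (2 * k) ≤
      (2 * k).factorial / (k : ℝ) ^ k * (Real.exp (√k * z) + Real.exp (-√k * z)) := fun z => by
    have h3 := Real.pow_div_factorial_le_exp (√k * |z|) (by positivity) (2 * k)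
    have h4 : Real.exp (√k * |z|) ≤ Real.exp (√k * z) + Real.exp (-√k * z) := by
      rcases abs_cases z with ⟨h, -⟩ | ⟨h, -⟩ <;> rw [h]
      · linarith [Real.exp_pos (-√k * z)]
      · rw [neg_mul, mul_neg]
        linarith [Real.exp_pos (√k * z)]
    have h5 : (√(k : ℝ) * |z|) ^ (2 * k) = (k : ℝ) ^ k * |z| ^ (2 * k) := by
      rw [mul_pow, pow_mul, hs]
    rw [h5, div_le_iff₀ (by positivity)] at h3
    rw [div_mul_eq_mul_div, le_div_iff₀ (by positivity)]
    calc |z| ^ (2 * k) * (k : ℝ) ^ k ≤ Real.exp (√k * |z|) * (2 * k).factorial := by linarith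
      _ ≤ (Real.exp (√k * z) + Real.exp (-√k * z)) * (2 * k).factorial := by gcongr
      _ = _ := mul_comm _ _
  calc _ ≤ ∑ ω : E → Bool, prodWeight (bernoulliWeight (1 / 2)) ω *
        ((2 * k).factorial / (k : ℝ) ^ k * (Real.exp (√k * ∑ e, boolSign (ω e) * c e) +
          Real.exp (-√k * ∑ e, boolSign (ω e) * c e))) :=
        Finset.sum_le_sum fun ω _ => mul_le_mul_of_nonneg_left (hpt _) (hw ω)
    _ = (2 * k).factorial / (k : ℝ) ^ k * (∑ ω : E → Bool, prodWeight (bernoulliWeight (1 / 2)) ω *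
        Real.exp (√k * ∑ e, boolSign (ω e) * c e) +
        ∑ ω : E → Bool, prodWeight (bernoulliWeight (1 / 2)) ω *
        Real.exp (-√k * ∑ e, boolSign (ω e) * c e)) := by
        rw [← Finset.sum_add_distrib, Finset.mul_sum]
        exact Finset.sum_congr rfl fun ω _ => by ring
    _ ≤ (2 * k) ^ (2 * k) / (k : ℝ) ^ k * (Real.exp k + Real.exp k) := by
        have hf : ((2 * k).factorial : ℝ) ≤ (2 * k) ^ (2 * k) := by
          exact_mod_cast Nat.factorial_le_pow (2 * k)
        exact mul_le_mul (div_le_div_of_nonneg_right hf (by positivity)) (add_le_add h1 h2)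
          (add_nonneg (Finset.sum_nonneg fun ω _ => mul_nonneg (hw ω) (Real.exp_pos _).le)
            (Finset.sum_nonneg fun ω _ => mul_nonneg (hw ω) (Real.exp_pos _).le)) (by positivity)
    _ = 2 * (4 * k * Real.exp 1) ^ k := by
        rw [← Real.exp_one_pow k, pow_mul, mul_pow (4 * (k : ℝ)), mul_pow (2 : ℝ), mul_pow 4,
          mul_pow, ← pow_mul (k : ℝ)]
        field_simp
        norm_num
        ring
    _ ≤ 2 * (12 * k) ^ k := by
        have he := Real.exp_one_lt_d9
        have : 4 * (k : ℝ) * Real.exp 1 ≤ 12 * k := by nlinarith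
        gcongr

end SignMatrix

/-- High moments of the norm of a random sign matrix whose size is comparable to the moment. -/
theorem sign_matrix_norm_moment {V : Type*} [Fintype V] [DecidableEq V] {k : ℕ} (hk : 1 ≤ k)
    (hV : Fintype.card V = 4 * k) :
    ∑ ω : Sym2 V → Bool, prodWeight (bernoulliWeight (1 / 2)) ω *
      ‖symMatrix fun e => boolSign (ω e)‖ ^ (2 * k) ≤ (150000000 * k) ^ k := by
  have hw := prodWeight_nonneg (E := Sym2 V)
    (bernoulliWeight_nonneg (p := 1 / 2) ⟨by norm_num, by norm_num⟩)
  -- Dimension `4k` and moment `2k` are comparable, so summing over all pairs of net points costs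
  -- only `5 ^ (8k)`. The final constant is `5 ^ 8 * 16 * 24`.
  obtain ⟨S, hcard, hS1, hS⟩ := exists_half_net (EuclideanSpace ℝ V)
  rw [finrank_euclideanSpace, hV] at hcard
  have hne : S.Nonempty := by
    have : Nonempty V := Fintype.card_pos_iff.1 (by omega)
    obtain ⟨v⟩ := this
    obtain ⟨y, hy, -⟩ := hS (EuclideanSpace.single v 1) (by simp)
    exact ⟨y, hy⟩
  have hpt : ∀ h : Sym2 V → ℝ, ‖symMatrix h‖ ^ (2 * k) ≤
      ∑ x ∈ S, ∑ y ∈ S, 16 ^ k * |∑ e, h e * pairCoeff x y e| ^ (2 * k) := fun h => by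
    obtain ⟨x, hx, y, hy, hle⟩ := opNorm_le_four_mul_inner hne hS
      (Matrix.toEuclideanCLM (𝕜 := ℝ) (symMatrix h))
    rw [bilin_symMatrix, Matrix.l2_opNorm_toEuclideanCLM] at hle
    calc _ ≤ (4 * |∑ e, h e * pairCoeff x y e|) ^ (2 * k) := by gcongr
      _ = 16 ^ k * |∑ e, h e * pairCoeff x y e| ^ (2 * k) := by
        rw [mul_pow, pow_mul]; norm_num
      _ ≤ ∑ y ∈ S, 16 ^ k * |∑ e, h e * pairCoeff x y e| ^ (2 * k) :=
        Finset.single_le_sum (f := fun y => 16 ^ k * |∑ e, h e * pairCoeff x y e| ^ (2 * k))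
          (fun _ _ => by positivity) hy
      _ ≤ _ := Finset.single_le_sum
          (f := fun x => ∑ y ∈ S, 16 ^ k * |∑ e, h e * pairCoeff x y e| ^ (2 * k))
          (fun _ _ => Finset.sum_nonneg fun _ _ => by positivity) hx
  calc _ ≤ ∑ ω : Sym2 V → Bool, prodWeight (bernoulliWeight (1 / 2)) ω *
        ∑ x ∈ S, ∑ y ∈ S, 16 ^ k * |∑ e, boolSign (ω e) * pairCoeff x y e| ^ (2 * k) :=
        Finset.sum_le_sum fun ω _ => mul_le_mul_of_nonneg_left (hpt _) (hw ω)
    _ = ∑ x ∈ S, ∑ y ∈ S, 16 ^ k * ∑ ω : Sym2 V → Bool, prodWeight (bernoulliWeight (1 / 2)) ω *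
        |∑ e, boolSign (ω e) * pairCoeff x y e| ^ (2 * k) := by
        simp only [Finset.mul_sum]
        rw [Finset.sum_comm]
        refine Finset.sum_congr rfl fun x _ => ?_
        rw [Finset.sum_comm]
        exact Finset.sum_congr rfl fun y _ => Finset.sum_congr rfl fun ω _ => by ring
    _ ≤ ∑ x ∈ S, ∑ y ∈ S, (16 : ℝ) ^ k * (2 * (12 * k) ^ k) := by
        refine Finset.sum_le_sum fun x hx => Finset.sum_le_sum fun y hy => ?_
        gcongr
        exact sign_moment _ (sum_pairCoeff_sq_le x y (hS1 x hx) (hS1 y hy)) hk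
    _ = (S.card : ℝ) * S.card * ((16 : ℝ) ^ k * (2 * (12 * k) ^ k)) := by
        simp only [Finset.sum_const, nsmul_eq_mul]; ring
    _ ≤ ((5 : ℝ) ^ (4 * k)) * (5 ^ (4 * k)) * (16 ^ k * (2 ^ k * (12 * k) ^ k)) := by
        have h5 : (S.card : ℝ) ≤ 5 ^ (4 * k) := by exact_mod_cast hcard
        have h2 : (2 : ℝ) ≤ 2 ^ k := by
          simpa using pow_le_pow_right₀ (one_le_two (α := ℝ)) hk
        gcongr
    _ = (150000000 * k) ^ k := by
        rw [show 150000000 * (k : ℝ) = 5 ^ 4 * 5 ^ 4 * (16 * (2 * (12 * k))) by ring]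
        simp only [mul_pow, pow_mul]

/-! ### Symmetrisation and the expected norm -/

/-- The product of two copies of a Bernoulli weight. -/
noncomputable def bernoulliPairWeight (p : ℝ) (b : Bool × Bool) : ℝ :=
  bernoulliWeight p b.1 * bernoulliWeight p b.2

/-- The difference of two Booleans, as a real number. -/
noncomputable def boolDiff (b : Bool × Bool) : ℝ := boolReal b.1 - boolReal b.2

lemma sum_bernoulliPairWeight (p : ℝ) : ∑ b, bernoulliPairWeight p b = 1 := by
  simp only [Fintype.sum_prod_type, Fintype.sum_bool, bernoulliPairWeight, bernoulliWeight]
  simp only [if_true, Bool.false_eq_true, if_false]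
  ring

lemma sum_boolDiff_odd (p : ℝ) (j : ℕ) (hj : Odd j) :
    ∑ b, bernoulliPairWeight p b * boolDiff b ^ j = 0 := by
  simp only [Fintype.sum_prod_type, Fintype.sum_bool, bernoulliPairWeight, bernoulliWeight,
    boolDiff, boolReal]
  simp only [if_true, Bool.false_eq_true, if_false, sub_self, zero_sub, sub_zero, one_pow,
    hj.neg_one_pow, zero_pow hj.pos.ne']
  ring

lemma sum_boolDiff_even (p : ℝ) (j : ℕ) (hj : Even j) (h0 : j ≠ 0) :
    ∑ b, bernoulliPairWeight p b * boolDiff b ^ j = 2 * p * (1 - p) := by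
  simp only [Fintype.sum_prod_type, Fintype.sum_bool, bernoulliPairWeight, bernoulliWeight,
    boolDiff, boolReal]
  simp only [if_true, Bool.false_eq_true, if_false, sub_self, zero_sub, sub_zero, one_pow,
    hj.neg_one_pow, zero_pow h0]
  ring

section

variable {V : Type*} [Fintype V] [DecidableEq V]

lemma card_even_walks_le {W : Type*} [Fintype W] [DecidableEq W] {k : ℕ} (hk : 1 ≤ k)
    (hW : Fintype.card W = 4 * k) [DecidablePred (IsEvenWalk (V := W) (n := 2 * k))] :
    ((Finset.univ.filter fun u : Fin (2 * k + 1) → W => IsEvenWalk u).card : ℝ) ≤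
      Fintype.card W * (150000000 * k) ^ k := by
  have hw := prodWeight_nonneg (E := Sym2 W)
    (bernoulliWeight_nonneg (p := 1 / 2) ⟨by norm_num, by norm_num⟩)
  have h := expected_trace_pow_sign (V := W) (bernoulliWeight (1 / 2)) boolSign
    sum_half_boolSign_odd sum_half_boolSign_even (2 * k)
  calc _ = ∑ ω : Sym2 W → Bool, prodWeight (bernoulliWeight (1 / 2)) ω *
        ((symMatrix fun e => boolSign (ω e)) ^ (2 * k)).trace := by
        rw [h]; congr!
    _ ≤ ∑ ω : Sym2 W → Bool, prodWeight (bernoulliWeight (1 / 2)) ω *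
        (Fintype.card W * ‖symMatrix fun e => boolSign (ω e)‖ ^ (2 * k)) := by
        refine Finset.sum_le_sum fun ω _ => mul_le_mul_of_nonneg_left ?_ (hw ω)
        refine (Matrix.trace_le_card_mul_norm _).trans ?_
        gcongr
        exact norm_pow_le' _ (by omega)
    _ = Fintype.card W * ∑ ω : Sym2 W → Bool, prodWeight (bernoulliWeight (1 / 2)) ω *
        ‖symMatrix fun e => boolSign (ω e)‖ ^ (2 * k) := by
        rw [Finset.mul_sum]
        exact Finset.sum_congr rfl fun ω _ => by ring
    _ ≤ _ := by
        gcongr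
        exact sign_matrix_norm_moment hk hW

/-- High moments of the norm of the symmetrised adjacency matrix. -/
lemma symmetrized_norm_moment {p : ℝ} (hp : p ∈ Set.Icc (0 : ℝ) 1) {k : ℕ} (hk : 1 ≤ k)
    (hpk : Fintype.card V * p ≤ k) :
    ∑ ω : Sym2 V → Bool × Bool, prodWeight (bernoulliPairWeight p) ω *
      ‖symMatrix fun e => boolDiff (ω e)‖ ^ (2 * k) ≤
        Fintype.card V * (150000000 * k) ^ k := by
  classical
  obtain ⟨hp0, hp1⟩ := hp
  have hw := prodWeight_nonneg (E := Sym2 V) (μ := bernoulliPairWeight p) fun b =>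
    mul_nonneg (bernoulliWeight_nonneg ⟨hp0, hp1⟩ _) (bernoulliWeight_nonneg ⟨hp0, hp1⟩ _)
  have hk0 : (0 : ℝ) < k := by exact_mod_cast hk
  have hq0 : 0 ≤ 2 * p * (1 - p) := by nlinarith
  have h1 := expected_trace_pow_le (V := V) (bernoulliPairWeight p) boolDiff
    (q := 2 * p * (1 - p)) ⟨hq0, by nlinarith [sq_nonneg (2 * p - 1)]⟩
    (sum_bernoulliPairWeight p) (sum_boolDiff_odd p) (sum_boolDiff_even p) (2 * k)
  have hW : Fintype.card (Fin (4 * k)) = 4 * k := Fintype.card_fin _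
  -- With walks of length `2k`, the comparison on `4k` vertices needs `N * q ≤ 2k`, which holds
  -- because `q ≤ 2p` and `N * p ≤ k`.
  have h2 := sum_even_walks_le (V := V) (W := Fin (4 * k)) (n := 2 * k) hq0 (by rw [hW]; omega) (by
    rw [hW]
    push_cast
    have : (0 : ℝ) ≤ Fintype.card V * p * p := by positivity
    nlinarith)
  have h3 := card_even_walks_le hk hW
  have hW0 : (0 : ℝ) < Fintype.card (Fin (4 * k)) := by rw [hW]; push_cast; linarith
  have h4 : ∑ ω : Sym2 V → Bool × Bool, prodWeight (bernoulliPairWeight p) ω *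
      ‖symMatrix fun e => boolDiff (ω e)‖ ^ (2 * k) ≤
      ∑ ω : Sym2 V → Bool × Bool, prodWeight (bernoulliPairWeight p) ω *
        ((symMatrix fun e => boolDiff (ω e)) ^ (2 * k)).trace :=
    Finset.sum_le_sum fun ω _ => mul_le_mul_of_nonneg_left
      ((isHermitian_symMatrix _).norm_pow_le_trace_pow (by omega)) (hw ω)
  have h5 := h4.trans h1
  have h6 := (mul_le_mul_of_nonneg_right h5 hW0.le).trans (le_trans (le_of_eq (by congr!)) h2)
  have h7 : (Fintype.card V : ℝ) * (Finset.univ.filter fun w : Fin (2 * k + 1) → Fin (4 * k) =>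
      IsEvenWalk w).card ≤
      Fintype.card V * (Fintype.card (Fin (4 * k)) * (150000000 * k) ^ k) := by
    refine mul_le_mul_of_nonneg_left (le_trans (le_of_eq (by congr!)) h3) (by positivity)
  have h8 := h6.trans (le_trans (le_of_eq (by congr!)) h7)
  refine le_of_mul_le_mul_right (h8.trans (le_of_eq ?_)) hW0
  ring

lemma sum_prodWeight_boolReal {E : Type*} [Fintype E] [DecidableEq E] (p : ℝ) (e : E) :
    ∑ ω : E → Bool, prodWeight (bernoulliWeight p) ω * boolReal (ω e) = p := by
  have h := sum_prodWeight_mul_prod (E := E) (bernoulliWeight p)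
    fun e' b => if e' = e then boolReal b else 1
  have h1 : ∀ ω : E → Bool, ∏ e', (if e' = e then boolReal (ω e') else 1) = boolReal (ω e) :=
    fun ω => by rw [Finset.prod_ite_eq' Finset.univ e fun e' => boolReal (ω e')]; simp
  simp only [h1] at h
  rw [h, Finset.prod_eq_single e]
  · simp [bernoulliWeight, boolReal]
  · intro e' _ he
    simp [he, bernoulliWeight]
  · simp

/-- The centred adjacency matrix is dominated in mean by the symmetrised one. -/
lemma centered_norm_le_symmetrized {p : ℝ} (hp : p ∈ Set.Icc (0 : ℝ) 1) :
    ∑ ω : Sym2 V → Bool, prodWeight (bernoulliWeight p) ω *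
      ‖symMatrix fun e => boolReal (ω e) - p‖ ≤
    ∑ ω : Sym2 V → Bool × Bool, prodWeight (bernoulliPairWeight p) ω *
      ‖symMatrix fun e => boolDiff (ω e)‖ := by
  have hw := prodWeight_nonneg (E := Sym2 V) (bernoulliWeight_nonneg hp)
  have hw1 := sum_prodWeight (E := Sym2 V) (sum_bernoulliWeight p)
  rw [← (Equiv.arrowProdEquivProdArrow (Sym2 V) (fun _ => Bool) (fun _ => Bool)).symm.sum_comp,
    Fintype.sum_prod_type]
  refine Finset.sum_le_sum fun ω _ => ?_
  -- The centring `p` is the mean of an independent copy, so the triangle inequality for averages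
  -- suffices.
  have hdec : (symMatrix fun e => boolReal (ω e) - p) =
      ∑ ω' : Sym2 V → Bool, prodWeight (bernoulliWeight p) ω' •
        symMatrix fun e => boolDiff (ω e, ω' e) := by
    ext i j
    rw [Matrix.sum_apply]
    simp only [Matrix.smul_apply, symMatrix, Matrix.of_apply, smul_eq_mul, boolDiff, mul_sub,
      Finset.sum_sub_distrib, ← Finset.sum_mul, hw1, one_mul, sum_prodWeight_boolReal]
  rw [hdec]
  calc _ ≤ prodWeight (bernoulliWeight p) ω * ∑ ω' : Sym2 V → Bool,
        ‖prodWeight (bernoulliWeight p) ω' • symMatrix fun e => boolDiff (ω e, ω' e)‖ :=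
        mul_le_mul_of_nonneg_left (norm_sum_le _ _) (hw ω)
    _ = _ := by
        rw [Finset.mul_sum]
        refine Finset.sum_congr rfl fun ω' _ => ?_
        rw [norm_smul, Real.norm_of_nonneg (hw ω'), ← mul_assoc]
        congr 1
        simp only [prodWeight, ← Finset.prod_mul_distrib]
        rfl

/-- The expected norm of the centred adjacency matrix with independent symmetric entries. -/
theorem expected_centered_norm_le {p : ℝ} (hp : p ∈ Set.Icc (0 : ℝ) 1)
    (hV : 2 ≤ Fintype.card V) (hlog : Real.log (Fintype.card V) ≤ Fintype.card V * p) :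
    ∑ ω : Sym2 V → Bool, prodWeight (bernoulliWeight p) ω *
      ‖symMatrix fun e => boolReal (ω e) - p‖ ≤ 40000 * √(Fintype.card V * p) := by
  set N := Fintype.card V
  have hN2 : (2 : ℝ) ≤ N := by exact_mod_cast hV
  have hNp : 2 / 3 ≤ N * p := by
    have h1 := Real.log_le_log two_pos hN2
    have h2 := Real.log_two_gt_d9
    linarith
  set k := ⌈N * p⌉₊
  have hk1 : 1 ≤ k := Nat.ceil_pos.2 (by linarith)
  have hpk : N * p ≤ k := Nat.le_ceil _
  have hk2 : (k : ℝ) ≤ 5 / 2 * (N * p) := by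
    have := Nat.ceil_lt_add_one (a := N * p) (by linarith)
    change (k : ℝ) < _ at this
    linarith
  refine (centered_norm_le_symmetrized hp).trans ?_
  have hw := prodWeight_nonneg (E := Sym2 V) (μ := bernoulliPairWeight p) fun b =>
    mul_nonneg (bernoulliWeight_nonneg hp _) (bernoulliWeight_nonneg hp _)
  have hw1 := sum_prodWeight (E := Sym2 V) (sum_bernoulliPairWeight p)
  set m := ∑ ω : Sym2 V → Bool × Bool, prodWeight (bernoulliPairWeight p) ω *
      ‖symMatrix fun e => boolDiff (ω e)‖ with hm
  have hm0 : 0 ≤ m := Finset.sum_nonneg fun ω _ => mul_nonneg (hw ω) (norm_nonneg _)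
  have hpow : m ^ (2 * k) ≤ N * (150000000 * k) ^ k :=
    (Real.pow_arith_mean_le_arith_mean_pow Finset.univ _ _ (fun ω _ => hw ω) hw1
      (fun ω _ => norm_nonneg _) (2 * k)).trans (symmetrized_norm_moment hp hk1 hpk)
  -- This is where `log N ≤ N * p` makes the trace prefactor harmless.
  have hNe : (N : ℝ) ≤ 3 ^ k := by
    calc (N : ℝ) = Real.exp (Real.log N) := (Real.exp_log (by linarith)).symm
      _ ≤ Real.exp k := Real.exp_le_exp.2 (hlog.trans hpk)
      _ = Real.exp 1 ^ k := (Real.exp_one_pow k).symm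
      _ ≤ 3 ^ k := by
        have := Real.exp_one_lt_d9
        gcongr
        linarith
  have h2 : (m ^ 2) ^ k ≤ (450000000 * k) ^ k := by
    calc (m ^ 2) ^ k = m ^ (2 * k) := (pow_mul _ _ _).symm
      _ ≤ N * (150000000 * k) ^ k := hpow
      _ ≤ 3 ^ k * (150000000 * k) ^ k := by gcongr
      _ = (450000000 * k) ^ k := by rw [← mul_pow]; congr 1; ring
  have h3 : m ^ 2 ≤ 450000000 * k :=
    (pow_le_pow_iff_left₀ (by positivity) (by positivity) (by omega)).1 h2
  rw [← Real.sqrt_sq hm0, show (40000 : ℝ) = √(40000 ^ 2) by rw [Real.sqrt_sq (by norm_num)],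
    ← Real.sqrt_mul (by positivity)]
  refine Real.sqrt_le_sqrt ?_
  nlinarith

end

/-! ### The support function controlling the leading eigenvalues -/

section KyFan

variable {V : Type*} [Fintype V]

/-- The entrywise inner product of matrices. -/
def entryInner (M U : Matrix V V ℝ) : ℝ := ∑ i, ∑ j, M i j * U i j

lemma entryInner_add_left (M M' U : Matrix V V ℝ) :
    entryInner (M + M') U = entryInner M U + entryInner M' U := by
  simp [entryInner, add_mul, Finset.sum_add_distrib]

lemma entryInner_smul_left (a : ℝ) (M U : Matrix V V ℝ) :
    entryInner (a • M) U = a * entryInner M U := by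
  simp [entryInner, Finset.mul_sum, mul_assoc]

lemma entryInner_le_frobenius (M : Matrix V V ℝ) {U : Matrix V V ℝ}
    (hU : ∑ i, ∑ j, U i j ^ 2 ≤ 1) : entryInner M U ≤ √(∑ i, ∑ j, M i j ^ 2) := by
  refine Real.le_sqrt_of_sq_le ?_
  simp only [entryInner, ← Fintype.sum_prod_type'] at hU ⊢
  refine (Finset.sum_mul_sq_le_sq_mul_sq _ (fun z : V × V => M z.1 z.2) _).trans ?_
  exact mul_le_of_le_one_right (Finset.sum_nonneg fun _ _ => sq_nonneg _) hU

/-- A combination of rank one projections on orthonormal vectors. -/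
noncomputable def projComb {V ι : Type*} [Fintype V] [Fintype ι] (v : ι → EuclideanSpace ℝ V) (c : ι → ℝ) :
    Matrix V V ℝ := Matrix.of fun i j => ∑ a, c a * (v a i * v a j)

lemma entryInner_projComb {ι : Type*} [Fintype ι] (v : ι → EuclideanSpace ℝ V) (c : ι → ℝ)
    (M : Matrix V V ℝ) :
    entryInner M (projComb v c) = ∑ a, c a * ∑ i, ∑ j, v a i * M i j * v a j := by
  simp only [entryInner, projComb, Matrix.of_apply, Finset.mul_sum]
  rw [Finset.sum_comm (s := Finset.univ (α := ι))]
  refine Finset.sum_congr rfl fun i _ => ?_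
  rw [Finset.sum_comm]
  exact Finset.sum_congr rfl fun a _ => Finset.sum_congr rfl fun j _ => by ring

variable [DecidableEq V]

/-- Matrices of Frobenius norm at most `1` and of nuclear norm at most `√R`. -/
def testMatrices (V : Type*) [Fintype V] [DecidableEq V] (R : ℕ) : Set (Matrix V V ℝ) :=
  {U | ∑ i, ∑ j, U i j ^ 2 ≤ 1 ∧ ∀ M : Matrix V V ℝ, entryInner M U ≤ √R * ‖M‖}

/-- The support function of the test matrices; on symmetric matrices it controls the `ℓ²` norm
of the `R` largest eigenvalues. -/
noncomputable def kyFan (R : ℕ) (M : Matrix V V ℝ) : ℝ :=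
  ⨆ U : testMatrices V R, entryInner M U

instance (R : ℕ) : Nonempty (testMatrices V R) :=
  ⟨⟨0, by simp, fun M => by simp only [entryInner, Matrix.zero_apply, mul_zero,
    Finset.sum_const_zero]; positivity⟩⟩

lemma entryInner_le_kyFan {R : ℕ} (M : Matrix V V ℝ) {U : Matrix V V ℝ}
    (hU : U ∈ testMatrices V R) : entryInner M U ≤ kyFan R M :=
  le_ciSup (f := fun U : testMatrices V R => entryInner M U)
    ⟨√R * ‖M‖, by rintro _ ⟨U, rfl⟩; exact U.2.2 M⟩ ⟨U, hU⟩

lemma kyFan_le_norm (R : ℕ) (M : Matrix V V ℝ) : kyFan R M ≤ √R * ‖M‖ :=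
  ciSup_le fun U => U.2.2 M

lemma convexOn_kyFan_symMatrix (R : ℕ) (p : ℝ) :
    ConvexOn ℝ Set.univ fun x : Sym2 V → ℝ => kyFan R (symMatrix fun e => x e - p) := by
  refine ⟨convex_univ, fun x _ y _ a b ha hb hab => ciSup_le fun U => ?_⟩
  have : (symMatrix fun e => (a • x + b • y) e - p) =
      a • (symMatrix fun e => x e - p) + b • (symMatrix fun e => y e - p) := by
    ext i j
    simp only [symMatrix, Matrix.of_apply, Matrix.add_apply, Matrix.smul_apply, Pi.add_apply,
      Pi.smul_apply, smul_eq_mul]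
    linear_combination p * hab
  rw [this, entryInner_add_left, entryInner_smul_left, entryInner_smul_left]
  exact add_le_add (mul_le_mul_of_nonneg_left (entryInner_le_kyFan _ U.2) ha)
    (mul_le_mul_of_nonneg_left (entryInner_le_kyFan _ U.2) hb)

/-- Test matrices have Frobenius norm at most `1`, and each unordered pair occupies at most two
matrix entries; hence `√2`, independently of `R`. -/
lemma kyFan_symMatrix_sub_le (R : ℕ) (p : ℝ) (x y : Sym2 V → ℝ) :
    kyFan R (symMatrix fun e => x e - p) - kyFan R (symMatrix fun e => y e - p) ≤
      √2 * √(∑ e, (x e - y e) ^ 2) := by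
  rw [sub_le_iff_le_add', ← Real.sqrt_mul zero_le_two]
  refine ciSup_le fun U => ?_
  have : (symMatrix fun e => x e - p) =
      (symMatrix fun e => y e - p) + symMatrix fun e => x e - y e := by
    ext i j
    simp [symMatrix]
  rw [this, entryInner_add_left]
  refine add_le_add (entryInner_le_kyFan _ U.2) ((entryInner_le_frobenius _ U.2.1).trans ?_)
  exact Real.sqrt_le_sqrt (sum_sum_sym2_le (fun e => (x e - y e) ^ 2) fun _ => sq_nonneg _)

/-- Orthonormality makes the squared Frobenius norm `∑ c²`, and Cauchy–Schwarz bounds `∑ |c|` by the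
square root of the number of vectors. -/
lemma projComb_mem_testMatrices {ι : Type*} [Fintype ι] {v : ι → EuclideanSpace ℝ V}
    (hv : Orthonormal ℝ v) {c : ι → ℝ} (hc : ∑ a, c a ^ 2 ≤ 1) :
    projComb v c ∈ testMatrices V (Fintype.card ι) := by
  classical
  have hin : ∀ a b, ∑ i, v a i * v b i = if a = b then 1 else 0 := fun a b => by
    rw [← orthonormal_iff_ite.1 hv a b, PiLp.inner_apply]
    exact Finset.sum_congr rfl fun i _ => by simp [mul_comm]
  constructor
  · have h1 : ∑ i, ∑ j, projComb v c i j ^ 2 = entryInner (projComb v c) (projComb v c) := by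
      simp only [entryInner, sq]
    rw [h1, entryInner_projComb]
    refine le_trans (le_of_eq (Finset.sum_congr rfl fun a _ => ?_)) hc
    have h2 : ∑ i, ∑ j, v a i * projComb v c i j * v a j =
        ∑ b, c b * ((∑ i, v a i * v b i) * ∑ j, v a j * v b j) := by
      simp only [projComb, Matrix.of_apply, Finset.mul_sum, Finset.sum_mul]
      rw [Finset.sum_comm (s := Finset.univ (α := ι))]
      rw [Finset.sum_comm]
      refine Finset.sum_congr rfl fun j _ => ?_
      rw [Finset.sum_comm]
      exact Finset.sum_congr rfl fun b _ => Finset.sum_congr rfl fun i _ => by ring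
    rw [h2]
    simp [hin, sq]
  · intro M
    rw [entryInner_projComb]
    have h1 : ∀ a, c a * ∑ i, ∑ j, v a i * M i j * v a j ≤ |c a| * ‖M‖ := fun a => by
      have := Matrix.abs_inner_le_norm M (v a) (v a)
      rw [hv.1 a, mul_one, mul_one] at this
      calc _ ≤ |c a * ∑ i, ∑ j, v a i * M i j * v a j| := le_abs_self _
        _ ≤ _ := by rw [abs_mul]; gcongr
    refine (Finset.sum_le_sum fun a _ => h1 a).trans ?_
    rw [← Finset.sum_mul]
    refine mul_le_mul_of_nonneg_right (Real.le_sqrt_of_sq_le ?_) (norm_nonneg _)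
    refine sq_sum_le_card_mul_sum_sq.trans ?_
    simp only [sq_abs, Finset.card_univ]
    exact mul_le_of_le_one_right (Nat.cast_nonneg _) hc

end KyFan

/-! ### From the support function to individual eigenvalues -/

lemma eigenvalueByModulus_succ {N : ℕ} {A : Matrix (Fin N) (Fin N) ℝ} (hA : A.IsHermitian)
    {j : ℕ} (hj : j < N) : eigenvalueByModulus hA (j + 1) =
      hA.eigenvalues (Tuple.sort (fun i => -|hA.eigenvalues i|) ⟨j, hj⟩) := by
  rw [eigenvalueByModulus, dif_pos ⟨by omega, by omega⟩]
  rfl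

lemma abs_eigenvalueByModulus_anti {N : ℕ} {A : Matrix (Fin N) (Fin N) ℝ} (hA : A.IsHermitian)
    {i j : ℕ} (hi : 1 ≤ i) (hij : i ≤ j) (hj : j ≤ N) :
    |eigenvalueByModulus hA j| ≤ |eigenvalueByModulus hA i| := by
  obtain ⟨i, rfl⟩ : ∃ k, i = k + 1 := ⟨i - 1, by omega⟩
  obtain ⟨j, rfl⟩ : ∃ k, j = k + 1 := ⟨j - 1, by omega⟩
  rw [eigenvalueByModulus_succ hA (by omega : i < N), eigenvalueByModulus_succ hA (by omega : j < N)]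
  have := Tuple.monotone_sort (fun i => -|hA.eigenvalues i|)
    (show (⟨i, by omega⟩ : Fin N) ≤ ⟨j, by omega⟩ from by simpa using by omega)
  simpa using this

/-- The `ℓ²` norm of the `R` largest eigenvalues is attained on a test matrix. -/
lemma exists_testMatrix_eigenvalues {N R : ℕ} (hR : R ≤ N) {A : Matrix (Fin N) (Fin N) ℝ}
    (hA : A.IsHermitian) : ∃ U ∈ testMatrices (Fin N) R,
      entryInner A U = √(∑ j ∈ Finset.Icc 1 R, eigenvalueByModulus hA j ^ 2) := by
  set σ : Fin R → Fin N := fun i => Tuple.sort (fun i => -|hA.eigenvalues i|) (Fin.castLE hR i)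
  have hσ : Function.Injective σ := (Equiv.injective _).comp (Fin.castLE_injective hR)
  have hsum : ∑ j ∈ Finset.Icc 1 R, eigenvalueByModulus hA j ^ 2 =
      ∑ i : Fin R, hA.eigenvalues (σ i) ^ 2 := by
    rw [show Finset.Icc 1 R = Finset.Ico (0 + 1) (R + 1) by ext; simp,
      ← Finset.sum_Ico_add' _ 0 R 1, ← Finset.range_eq_Ico,
      Finset.sum_range]
    exact Finset.sum_congr rfl fun i _ => by
      rw [eigenvalueByModulus_succ hA (i.2.trans_le hR)]; rfl
  set T := ∑ i : Fin R, hA.eigenvalues (σ i) ^ 2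
  have hT : 0 ≤ T := Finset.sum_nonneg fun _ _ => sq_nonneg _
  set v : Fin R → EuclideanSpace ℝ (Fin N) := fun i => hA.eigenvectorBasis (σ i)
  have hv : Orthonormal ℝ v := hA.eigenvectorBasis.orthonormal.comp σ hσ
  have hquad : ∀ a, ∑ i, ∑ j, v a i * A i j * v a j = hA.eigenvalues (σ a) := fun a => by
    rw [hA.eigenvalues_eq]
    simp [dotProduct, Matrix.mulVec, Finset.mul_sum, mul_assoc, v]
  -- The normalised eigenvalues are the extremal coefficients. If `T = 0`, division by zero makes
  -- them all `0` and both sides vanish.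
  refine ⟨projComb v fun a => hA.eigenvalues (σ a) / √T, ?_, ?_⟩
  · have := projComb_mem_testMatrices hv (c := fun a => hA.eigenvalues (σ a) / √T) (by
      simp only [div_pow, Real.sq_sqrt hT, ← Finset.sum_div]
      exact div_self_le_one T)
    rwa [Fintype.card_fin] at this
  · rw [entryInner_projComb, hsum]
    simp only [hquad]
    have : ∀ a, hA.eigenvalues (σ a) / √T * hA.eigenvalues (σ a) =
        hA.eigenvalues (σ a) ^ 2 / √T := fun a => by ring
    simp only [this, ← Finset.sum_div]
    exact Real.div_sqrt

open Classical in
/-- Comparison of an adjacency matrix with the centred matrix of independent entries. -/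
lemma sqrt_sum_adjEigenvalue_sq_le {N R : ℕ} (hR : R ≤ N) {p : ℝ} (hp : 0 ≤ p)
    (ω : Sym2 (Fin N) → Bool) {G : SimpleGraph (Fin N)}
    (hG : ∀ i j, G.Adj i j ↔ ω s(i, j) = true ∧ i ≠ j) :
    √(∑ j ∈ Finset.Icc 1 R, adjEigenvalue G j ^ 2) ≤
      kyFan R (symMatrix fun e => boolReal (ω e) - p) + p * N + √R := by
  obtain ⟨U, hU, hUe⟩ := exists_testMatrix_eigenvalues hR (G.isHermitian_adjMatrix ℝ)
  change √(∑ j ∈ Finset.Icc 1 R, eigenvalueByModulus (G.isHermitian_adjMatrix ℝ) j ^ 2) ≤ _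
  rw [← hUe]
  set J : Matrix (Fin N) (Fin N) ℝ := Matrix.of fun _ _ => 1
  set D : Matrix (Fin N) (Fin N) ℝ := Matrix.diagonal fun i => -boolReal (ω s(i, i))
  -- Besides the centred matrix there are a rank-one mean, charged through the Frobenius bound, and
  -- a loop correction of operator norm at most `1`, charged through the nuclear bound.
  have hdec : G.adjMatrix ℝ = (symMatrix fun e => boolReal (ω e) - p) + p • J + D := by
    ext i j
    simp only [SimpleGraph.adjMatrix_apply, Matrix.add_apply, Matrix.smul_apply, J, D, symMatrix,
      Matrix.of_apply, Matrix.diagonal_apply, smul_eq_mul, hG, boolReal]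
    by_cases hij : i = j
    · subst hij
      simp
    · by_cases hb : ω s(i, j) = true <;> simp [hij, hb]
  have hJ : entryInner J U ≤ N := by
    refine (entryInner_le_frobenius J hU.1).trans ?_
    simp only [J, Matrix.of_apply, one_pow, Finset.sum_const, Finset.card_univ, Fintype.card_fin,
      nsmul_eq_mul, mul_one]
    rw [Real.sqrt_mul_self (Nat.cast_nonneg _)]
  have hD : entryInner D U ≤ √R := by
    refine (hU.2 D).trans (mul_le_of_le_one_right (Real.sqrt_nonneg _) ?_)
    rw [Matrix.l2_opNorm_diagonal]
    refine (pi_norm_le_iff_of_nonneg zero_le_one).2 fun i => ?_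
    have := boolReal_mem (ω s(i, i))
    rw [norm_neg, Real.norm_of_nonneg this.1]
    exact this.2
  rw [hdec, entryInner_add_left, entryInner_add_left, entryInner_smul_left]
  have := entryInner_le_kyFan (symMatrix fun e => boolReal (ω e) - p) hU
  gcongr

/-- Bounds on a sequence of decreasing modulus from bounds on the `ℓ²` norms of its initial
segments. -/
lemma bounds_of_l2_initial_segments {N : ℕ} {l : ℕ → ℝ} {a b C : ℝ} (ha : 0 ≤ a) (hb : 0 ≤ b)
    (hC : 0 ≤ C) (hanti : ∀ i j, 1 ≤ i → i ≤ j → j ≤ N → |l j| ≤ |l i|)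
    (hT : ∀ R, 1 ≤ R → R ≤ N → √(∑ j ∈ Finset.Icc 1 R, l j ^ 2) ≤ C * (√R * a + b))
    {R : ℕ} (hR : 1 ≤ R) (hRN : R ≤ N) :
    |l R| ≤ C * (a + b / √R) ∧ ∀ α : ℝ, 2 < α →
      ∑ j ∈ Finset.Ioc R N, |l j| ^ α ≤
        (2 * C) ^ α * (N * a ^ α + b ^ α / (R : ℝ) ^ (α / 2 - 1)) := by
  have hfirst : ∀ R : ℕ, 1 ≤ R → R ≤ N → |l R| ≤ C * (a + b / √R) := fun R hR hRN => by
    have hR0 : (0 : ℝ) < R := by exact_mod_cast hR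
    have hs : 0 < √(R : ℝ) := Real.sqrt_pos.2 hR0
    have h1 : √R * |l R| ≤ √(∑ j ∈ Finset.Icc 1 R, l j ^ 2) := by
      refine Real.le_sqrt_of_sq_le ?_
      rw [mul_pow, Real.sq_sqrt hR0.le]
      calc (R : ℝ) * |l R| ^ 2 = ∑ j ∈ Finset.Icc 1 R, |l R| ^ 2 := by simp
        _ ≤ ∑ j ∈ Finset.Icc 1 R, l j ^ 2 := by
          refine Finset.sum_le_sum fun j hj => ?_
          rw [Finset.mem_Icc] at hj
          rw [← sq_abs (l j)]
          exact pow_le_pow_left₀ (abs_nonneg _) (hanti j R hj.1 hj.2 hRN) 2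
    have h2 := h1.trans (hT R hR hRN)
    refine le_of_mul_le_mul_left (h2.trans (le_of_eq ?_)) hs
    field_simp
  refine ⟨hfirst R hR hRN, fun α hα => ?_⟩
  have hR0 : (0 : ℝ) < R := by exact_mod_cast hR
  -- The split is at `√j * a = b`, where the two terms of the bound balance. Past it each `|l j|` is
  -- at most `2 * C * a`.
  rw [← Finset.sum_filter_add_sum_filter_not (Finset.Ioc R N) (fun j : ℕ => b ^ 2 < j * a ^ 2), mul_add]
  refine add_le_add ?_ ?_
  · calc _ ≤ ∑ j ∈ (Finset.Ioc R N).filter (fun j : ℕ => b ^ 2 < j * a ^ 2), (2 * C) ^ α * a ^ α := by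
          refine Finset.sum_le_sum fun j hj => ?_
          obtain ⟨hj, hjb⟩ := Finset.mem_filter.1 hj
          rw [Finset.mem_Ioc] at hj
          have hj0 : (0 : ℝ) < j := by exact_mod_cast (by omega : 0 < j)
          have hbj : b / √j ≤ a := by
            rw [div_le_iff₀ (Real.sqrt_pos.2 hj0)]
            refine le_of_sq_le_sq ?_ (by positivity)
            rw [mul_pow, Real.sq_sqrt hj0.le]
            linarith
          have h1 := hfirst j (by omega) hj.2
          rw [← Real.mul_rpow (by positivity) ha]
          refine Real.rpow_le_rpow (abs_nonneg _) (h1.trans ?_) (by linarith)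
          nlinarith
      _ ≤ N * ((2 * C) ^ α * a ^ α) := by
          rw [Finset.sum_const, nsmul_eq_mul]
          refine mul_le_mul_of_nonneg_right ?_ (by positivity)
          have : ((Finset.Ioc R N).filter (fun j : ℕ => b ^ 2 < j * a ^ 2)).card ≤ N :=
            (Finset.card_filter_le _ _).trans (by simp)
          exact_mod_cast this
      _ = _ := by ring
  · set S := (Finset.Ioc R N).filter (fun j : ℕ => ¬ b ^ 2 < j * a ^ 2) with hS
    have hmem : ∀ j ∈ S, R < j ∧ j ≤ N ∧ √j * a ≤ b := fun j hj => by
      obtain ⟨hj, hjb⟩ := Finset.mem_filter.1 hj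
      rw [Finset.mem_Ioc] at hj
      refine ⟨hj.1, hj.2, le_of_sq_le_sq ?_ hb⟩
      rw [mul_pow, Real.sq_sqrt (Nat.cast_nonneg _)]
      exact not_lt.1 hjb
    -- Before the split, the ℓ² bound is combined with a uniform bound on `|l j| ^ (α - 2)`. Summing
    -- the pointwise bounds would instead produce a constant that blows up as `α` tends to `2`.
    have hsq : ∑ j ∈ S, l j ^ 2 ≤ (2 * C * b) ^ 2 := by
      rcases S.eq_empty_or_nonempty with h | h
      · rw [h, Finset.sum_empty]; positivity
      · obtain ⟨hm1, hm2, hm3⟩ := hmem _ (S.max'_mem h)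
        have h1 := hT (S.max' h) (by omega) hm2
        have h2 : √(∑ j ∈ Finset.Icc 1 (S.max' h), l j ^ 2) ≤ 2 * C * b := by nlinarith
        refine le_trans (Finset.sum_le_sum_of_subset_of_nonneg (fun j hj => ?_)
          fun _ _ _ => sq_nonneg _) (Real.sqrt_le_left (by positivity) |>.1 h2)
        have := hmem j hj
        exact Finset.mem_Icc.2 ⟨by omega, S.le_max' j hj⟩
    calc _ ≤ ∑ j ∈ S, (2 * C * b / √R) ^ (α - 2) * l j ^ 2 := by
          refine Finset.sum_le_sum fun j hj => ?_
          obtain ⟨hj1, hj2, hj3⟩ := hmem j hj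
          have hj0 : (0 : ℝ) < j := by exact_mod_cast (by omega : 0 < j)
          have h1 : |l j| ≤ 2 * C * b / √R := by
            refine (hfirst j (by omega) hj2).trans ?_
            have h2 : a ≤ b / √j := by
              rw [le_div_iff₀ (Real.sqrt_pos.2 hj0)]; linarith
            have h3 : b / √j ≤ b / √R := by
              have : (R : ℝ) ≤ j := by exact_mod_cast hj1.le
              gcongr
            calc C * (a + b / √j) ≤ C * (b / √R + b / √R) := by gcongr; exact h2.trans h3
              _ = _ := by ring
          rw [show α = (α - 2) + 2 by ring, Real.rpow_add_of_nonneg (abs_nonneg _)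
            (by linarith) zero_le_two, Real.rpow_two, sq_abs, add_sub_cancel_right]
          gcongr
      _ = (2 * C * b / √R) ^ (α - 2) * ∑ j ∈ S, l j ^ 2 := by rw [Finset.mul_sum]
      _ ≤ (2 * C * b / √R) ^ (α - 2) * (2 * C * b) ^ 2 := by gcongr
      _ = (2 * C) ^ α * (b ^ α / (R : ℝ) ^ (α / 2 - 1)) := by
          rw [Real.div_rpow (by positivity) (by positivity), Real.sqrt_eq_rpow,
            ← Real.rpow_mul hR0.le, ← mul_div_assoc, ← Real.mul_rpow (by positivity) hb,
            div_mul_eq_mul_div, ← Real.rpow_two, ← Real.rpow_add_of_nonneg (by positivity)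
            (by linarith) zero_le_two]
          congr 2 <;> ring

/-! ### The random graph as an image of a Bernoulli product -/

/-- The graph whose edges are the non-diagonal pairs selected by `ω`. -/
def boolGraph {V : Type*} (ω : Sym2 V → Bool) : SimpleGraph V :=
  SimpleGraph.fromEdgeSet {e | ω e = true}

lemma boolGraph_adj {V : Type*} (ω : Sym2 V → Bool) (i j : V) :
    (boolGraph ω).Adj i j ↔ ω s(i, j) = true ∧ i ≠ j := by
  simp [boolGraph]

lemma measurableSingletonClass_simpleGraph (V : Type*) [Finite V] :
     MeasurableSingletonClass (SimpleGraph V) := by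
  refine ⟨fun G => ?_⟩
  have : ({G} : Set (SimpleGraph V)) = SimpleGraph.edgeSet ⁻¹' {G.edgeSet} := by
    ext H
    simp
  rw [this]
  exact SimpleGraph.measurable_edgeSet (measurableSet_singleton _)

section

variable {V : Type*} [Fintype V] [DecidableEq V]

open Classical in
-- The graph fixes the coordinate at every non-diagonal pair; the diagonal coordinates are free and
-- sum out to `1`.
lemma sum_prodWeight_boolGraph_eq (p : ℝ) (G : SimpleGraph V) :
    ∑ ω : Sym2 V → Bool with boolGraph ω = G, prodWeight (bernoulliWeight p) ω =
      p ^ G.edgeSet.ncard * (1 - p) ^ ((Fintype.card V).choose 2 - G.edgeSet.ncard) := by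
  have hiff : ∀ ω : Sym2 V → Bool, boolGraph ω = G ↔
      ∀ e : Sym2 V, e.IsDiag ∨ (ω e = true ↔ e ∈ G.edgeSet) := fun ω => by
    constructor
    · rintro rfl e
      by_cases he : e.IsDiag
      · exact Or.inl he
      · simp [boolGraph, he]
    · intro h
      ext i j
      rw [boolGraph_adj]
      rcases h s(i, j) with h | h
      · have hij : i = j := by simpa using h
        simp [hij]
      · rw [h, SimpleGraph.mem_edgeSet]
        exact ⟨fun h => h.1, fun h => ⟨h, h.ne⟩⟩
  have hprod := sum_prodWeight_mul_prod (E := Sym2 V) (bernoulliWeight p)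
    fun e b => if e.IsDiag ∨ (b = true ↔ e ∈ G.edgeSet) then 1 else 0
  have hind : ∀ ω : Sym2 V → Bool,
      ∏ e : Sym2 V, (if e.IsDiag ∨ (ω e = true ↔ e ∈ G.edgeSet) then (1 : ℝ) else 0) =
        if boolGraph ω = G then 1 else 0 := fun ω => by
    rw [Finset.prod_boole]
    simp only [hiff, Finset.mem_univ, true_imp_iff]
  simp only [hind, mul_ite, mul_one, mul_zero] at hprod
  rw [Finset.sum_filter, hprod]
  have hloc : ∀ e : Sym2 V, (∑ b : Bool, if e.IsDiag ∨ (b = true ↔ e ∈ G.edgeSet) then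
      bernoulliWeight p b else 0) = if e.IsDiag then 1 else if e ∈ G.edgeSet then p else 1 - p :=
    fun e => by
      by_cases he : e.IsDiag
      · simp [he, bernoulliWeight]
      · by_cases hG : e ∈ G.edgeSet <;> simp [he, hG, bernoulliWeight]
  rw [Finset.prod_congr rfl fun e _ => hloc e, Finset.prod_ite, Finset.prod_const_one, one_mul,
    Finset.prod_ite, Finset.prod_const, Finset.prod_const]
  have hcardE : ((Finset.univ.filter fun e : Sym2 V => ¬ e.IsDiag).filter
      fun e => e ∈ G.edgeSet).card = G.edgeSet.ncard := by
    rw [Set.ncard_eq_toFinset_card', Finset.filter_filter]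
    congr 1
    ext e
    simp only [Finset.mem_filter, Finset.mem_univ, true_and, Set.mem_toFinset]
    exact ⟨fun h => h.2, fun h => ⟨G.not_isDiag_of_mem_edgeSet h, h⟩⟩
  have hcardAll : (Finset.univ.filter fun e : Sym2 V => ¬ e.IsDiag).card =
      (Fintype.card V).choose 2 := by
    rw [← Sym2.card_subtype_not_diag, Fintype.card_subtype]
  have hsplit := Finset.card_filter_add_card_filter_not
    (s := Finset.univ.filter fun e : Sym2 V => ¬ e.IsDiag) (fun e => e ∈ G.edgeSet)
  rw [hcardE]
  congr 2
  omega

open Classical in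
/-- The binomial random graph as the image of a product of Bernoulli spaces. -/
lemma binomialRandom_real_eq_sum (p : unitInterval) (S : Set (SimpleGraph V)) :
    (SimpleGraph.binomialRandom V p).real S =
      ∑ ω : Sym2 V → Bool with boolGraph ω ∈ S, prodWeight (bernoulliWeight p) ω := by
  have hS : S = ((Finset.univ.filter fun G => G ∈ S : Finset (SimpleGraph V)) :
      Set (SimpleGraph V)) := by
    ext; simp
  conv_lhs => rw [hS]
  have := measurableSingletonClass_simpleGraph V
  rw [← sum_measureReal_singleton, ← Finset.sum_fiberwise_of_maps_to
    (t := Finset.univ.filter fun G => G ∈ S) (g := boolGraph) (fun ω hω => by simpa using hω)]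
  refine Finset.sum_congr rfl fun G hG => ?_
  rw [Finset.filter_filter]
  have : (Finset.univ.filter fun ω : Sym2 V → Bool => boolGraph ω ∈ S ∧ boolGraph ω = G) =
      Finset.univ.filter fun ω : Sym2 V → Bool => boolGraph ω = G := by
    refine Finset.filter_congr fun ω _ => ⟨fun h => h.2, fun h => ⟨h ▸ (Finset.mem_filter.1 hG).2, h⟩⟩
  rw [this, sum_prodWeight_boolGraph_eq, measureReal_def, SimpleGraph.binomialRandom_singleton]
  simp [ENNReal.toReal_mul, ENNReal.toReal_pow]

lemma binomialRandom_real_le_sum (p : unitInterval) (S : Set (SimpleGraph V))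
    (T : Finset (Sym2 V → Bool)) (hT : ∀ ω, ω ∉ T → boolGraph ω ∉ S) :
    (SimpleGraph.binomialRandom V p).real S ≤ ∑ ω ∈ T, prodWeight (bernoulliWeight p) ω := by
  classical
  rw [binomialRandom_real_eq_sum]
  refine Finset.sum_le_sum_of_subset_of_nonneg (fun ω hω => ?_)
    fun ω _ _ => prodWeight_nonneg (bernoulliWeight_nonneg p.2) ω
  by_contra hcon
  exact hT ω hcon (by simpa using hω)

/-! ### Tail bound, union bound and conclusion -/

/-- Upper tail of the support function of the centred adjacency matrix. -/
lemma kyFan_upper_tail {p : ℝ} (hp : p ∈ Set.Icc (0 : ℝ) 1) (hV : 2 ≤ Fintype.card V)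
    (hlog : Real.log (Fintype.card V) ≤ Fintype.card V * p) (R : ℕ) {t : ℝ} (ht : 0 ≤ t)
    (S : Finset (Sym2 V → Bool))
    (hS : ∀ ω ∈ S, √R * (40000 * √(Fintype.card V * p)) + t ≤
      kyFan R (symMatrix fun e => boolReal (ω e) - p)) :
    ∑ ω ∈ S, prodWeight (bernoulliWeight p) ω ≤ Real.exp (-t ^ 2 / 16) := by
  have h := convex_upper_tail hp (convexOn_kyFan_symMatrix (V := V) R p)
    (L := √2) (m := √R * (40000 * √(Fintype.card V * p))) (t := t) (by positivity) ht
    (kyFan_symMatrix_sub_le R p) ?_ S hS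
  · refine h.trans (le_of_eq ?_)
    rw [Real.sq_sqrt zero_le_two]
    norm_num
  · have hw := prodWeight_nonneg (E := Sym2 V) (bernoulliWeight_nonneg hp)
    calc _ ≤ ∑ ω : Sym2 V → Bool, prodWeight (bernoulliWeight p) ω *
          (√R * ‖symMatrix fun e => boolReal (ω e) - p‖) :=
          Finset.sum_le_sum fun ω _ => mul_le_mul_of_nonneg_left (kyFan_le_norm R _) (hw ω)
      _ = √R * ∑ ω : Sym2 V → Bool, prodWeight (bernoulliWeight p) ω *
          ‖symMatrix fun e => boolReal (ω e) - p‖ := by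
          rw [Finset.mul_sum]
          exact Finset.sum_congr rfl fun ω _ => by ring
      _ ≤ _ := by
          gcongr
          exact expected_centered_norm_le hp hV hlog

end

lemma adjEigenvalue_bounds {N : ℕ} {p K : ℝ} (hp0 : 0 ≤ p) (hNp : 2 / 3 ≤ N * p) (hK : 1 ≤ K)
    {ω : Sym2 (Fin N) → Bool}
    (hω : ∀ R, 1 ≤ R → R ≤ N → kyFan R (symMatrix fun e => boolReal (ω e) - p) ≤
      √R * (40000 * √(N * p)) + K * N * p) {R : ℕ} (hR : 1 ≤ R) (hRN : R ≤ N) :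
    |adjEigenvalue (boolGraph ω) R| ≤ 80004 * (√(N * p) + K * N * p / √R) ∧
      ∀ α : ℝ, 2 < α → ∑ j ∈ Finset.Ioc R N, |adjEigenvalue (boolGraph ω) j| ^ α ≤
        80004 ^ α * ((N : ℝ) ^ (1 + α / 2) * p ^ (α / 2) +
          (K * N * p) ^ α / (R : ℝ) ^ (α / 2 - 1)) := by
  have hN : (0 : ℝ) < N := by
    have : 0 < N := by omega
    exact_mod_cast this
  have hb : 0 ≤ K * N * p := by positivity
  have hsq : 1 ≤ 2 * √(N * p) := by
    have : 1 / 2 ≤ √(N * p) := Real.le_sqrt_of_sq_le (by norm_num; linarith)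
    linarith
  have hpn : p * N ≤ K * N * p := by nlinarith
  -- Since `1 ≤ 2 * √(N * p)`, the loop term `√R` adds `2` to `40000`; the mean `p * N` is at most
  -- `K * N * p`. The doubled constant is `80004`.
  obtain ⟨h1, h2⟩ := bounds_of_l2_initial_segments (N := N) (l := adjEigenvalue (boolGraph ω))
    (a := √(N * p)) (b := K * N * p) (C := 40002) (Real.sqrt_nonneg _) hb (by norm_num)
    (fun i j hi hij hj => abs_eigenvalueByModulus_anti _ hi hij hj)
    (fun R hR hRN => by
      refine (sqrt_sum_adjEigenvalue_sq_le hRN hp0 ω (boolGraph_adj ω)).trans ?_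
      have := hω R hR hRN
      have hs := mul_le_mul_of_nonneg_left hsq (Real.sqrt_nonneg R)
      linarith) hR hRN
  refine ⟨h1.trans ?_, fun α hα => (h2 α hα).trans (le_of_eq ?_)⟩
  · gcongr
    norm_num
  · rw [Real.sqrt_eq_rpow, ← Real.rpow_mul (by positivity), Real.mul_rpow hN.le hp0,
      Real.rpow_add hN, Real.rpow_one]
    norm_num only
    ring_nf

lemma sum_biUnion_le_sum_sum {ι κ : Type*} [DecidableEq κ] (s : Finset ι) (t : ι → Finset κ)
    {f : κ → ℝ} (hf : ∀ x, 0 ≤ f x) : ∑ x ∈ s.biUnion t, f x ≤ ∑ i ∈ s, ∑ x ∈ t i, f x := by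
  classical
  induction s using Finset.induction_on with
  | empty => simp
  | insert a s ha ih =>
    rw [Finset.biUnion_insert, Finset.sum_insert ha]
    have h := Finset.sum_union_inter (s₁ := t a) (s₂ := s.biUnion t) (f := f)
    have : 0 ≤ ∑ x ∈ t a ∩ s.biUnion t, f x := Finset.sum_nonneg fun x _ => hf x
    linarith

theorem proposition2p1 :
    ∃ c C C₁ : ℝ, 0 < c ∧ 0 < C ∧ 0 < C₁ ∧
      ∀ (N : ℕ) (p : unitInterval) (K : ℝ),
        2 ≤ N → Real.log N ≤ N * (p : ℝ) → C ≤ K →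
        (SimpleGraph.binomialRandom (Fin N) p).real
            {G : SimpleGraph (Fin N) | ¬ ∀ R : ℕ, 1 ≤ R → R ≤ N →
              |adjEigenvalue G R| ≤
                  C₁ * (Real.sqrt (N * (p : ℝ)) + K * N * (p : ℝ) / Real.sqrt R) ∧
              ∀ α : ℝ, 2 < α →
                ∑ j ∈ Finset.Ioc R N, |adjEigenvalue G j| ^ α ≤
                  C₁ ^ α * ((N : ℝ) ^ (1 + α / 2) * (p : ℝ) ^ (α / 2) +
                    (K * N * (p : ℝ)) ^ α / (R : ℝ) ^ (α / 2 - 1))}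
          ≤ 4 * N * Real.exp (-c * K ^ 2 * (N : ℝ) ^ 2 * (p : ℝ) ^ 2) := by
  classical
  refine ⟨1 / 16, 1, 80004, by norm_num, one_pos, by norm_num, fun N p K hN hlog hK => ?_⟩
  have hp : (p : ℝ) ∈ Set.Icc (0 : ℝ) 1 := p.2
  have hNp : 2 / 3 ≤ N * (p : ℝ) := by
    have h1 := Real.log_le_log two_pos (show (2 : ℝ) ≤ N by exact_mod_cast hN)
    have h2 := Real.log_two_gt_d9
    linarith
  have hw := prodWeight_nonneg (E := Sym2 (Fin N)) (bernoulliWeight_nonneg hp)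
  -- `S R` is the bad event at level `R`, with deviation `t = K * N * p`. It does not involve `α`,
  -- so the union runs only over the `N` values of `R`.
  set S : ℕ → Finset (Sym2 (Fin N) → Bool) := fun R => Finset.univ.filter fun ω =>
    √R * (40000 * √(N * p)) + K * N * p ≤ kyFan R (symMatrix fun e => boolReal (ω e) - p)
  have htail : ∀ R, ∑ ω ∈ S R, prodWeight (bernoulliWeight p) ω ≤
      Real.exp (-(1 / 16) * K ^ 2 * (N : ℝ) ^ 2 * (p : ℝ) ^ 2) := fun R => by
    have h := kyFan_upper_tail (V := Fin N) hp (by simpa using hN) (by simpa using hlog) R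
      (t := K * N * p) (mul_nonneg (by positivity) hp.1) (S R) (fun ω hω => by
        simpa [S] using hω)
    refine h.trans (le_of_eq ?_)
    congr 1
    ring
  have hcover : ∀ ω, ω ∉ (Finset.Icc 1 N).biUnion S → ∀ R : ℕ, 1 ≤ R → R ≤ N → _ :=
    fun ω hω R hR hRN => adjEigenvalue_bounds hp.1 hNp hK (ω := ω) (fun R' hR' hRN' => by
      by_contra! hlt
      exact hω (Finset.mem_biUnion.2 ⟨R', Finset.mem_Icc.2 ⟨hR', hRN'⟩,
        Finset.mem_filter.2 ⟨Finset.mem_univ _, hlt.le⟩⟩)) hR hRN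
  calc _ ≤ ∑ ω ∈ (Finset.Icc 1 N).biUnion S, prodWeight (bernoulliWeight p) ω :=
        binomialRandom_real_le_sum _ _ _ fun ω hω => not_not_intro (hcover ω hω)
    _ ≤ ∑ R ∈ Finset.Icc 1 N, ∑ ω ∈ S R, prodWeight (bernoulliWeight p) ω :=
        sum_biUnion_le_sum_sum _ _ hw
    _ ≤ ∑ R ∈ Finset.Icc 1 N, Real.exp (-(1 / 16) * K ^ 2 * (N : ℝ) ^ 2 * (p : ℝ) ^ 2) :=
        Finset.sum_le_sum fun R _ => htail R
    _ = N * Real.exp (-(1 / 16) * K ^ 2 * (N : ℝ) ^ 2 * (p : ℝ) ^ 2) := by simp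
    _ ≤ 4 * N * Real.exp (-(1 / 16) * K ^ 2 * (N : ℝ) ^ 2 * (p : ℝ) ^ 2) := by
        gcongr
        linarith [show (0 : ℝ) ≤ N from Nat.cast_nonneg N]
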